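/- Let $R$ be a commutative ring and $A=\bigoplus_{j\in\mathbb Z}A_j$ a graded $R$-module. Its suspension $sA$ has $(sA)_j=A_{j-1}$. For $R$-modules $V,W$ let $TV=\bigoplus_{n\ge0}V^{\otimes n}$ with the deconcatenation coproduct $\Delta$, and $T^WV=\bigoplus_{k,l\ge 0}V^{\otimes k}\otimes W\otimes V^{\otimes l}$ with the coaction $\Delta^W:T^WV\to(TV\otimes T^WV)\oplus(T^WV\otimes TV)$, $$\Delta^W(v_1,\dots,v_k,w,v_{k+1},\dots,v_{k+l})=\sum_{i=0}^{k}(v_1,\dots,v_i)\otimes(v_{i+1},\dots,w,\dots,v_{k+l})+\sum_{i=k}^{k+l}(v_1,\dots,w,\dots,v_i)\otimes(v_{i+1},\dots,v_{k+l}).$$ Koszul signs are used throughout. Let $D$ be an $A_\infty$-algebra structure on $A$, that is, a coderivation of degree $-1$ of $T(sA)$ with $D^2=0$ and $D_0=0$, where $D_n:(sA)^{\otimes n}\to sA$ are the components of $D$. Define $m_n:A^{\otimes n}\to A$ by $D_n=s\circ m_n\circ(s^{-1})^{\otimes n}$, and write $\partial=m_1$. For $M=A$ and for $M=A^*=\mathrm{Hom}_R(A,R)$,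 where $(A^*)_j$ is the set of functionals vanishing on $A_i$ for all $i\ne-j$, let $D^M$ be the map of degree $-1$ on $T^{sM}(sA)$ that lifts over $D$ the maps $D^M_{k,l}=s\circ b^M_{k,l}\circ(s^{-1})^{\otimes k+l+1}$, where $b^A_{k,l}=m_{k+l+1}$ and $$b^{A^*}_{k,l}(a_1,\dots,a_k,a^*,a_{k+1},\dots,a_{k+l})(a)=(-1)^{\varepsilon}\,a^*\big(m_{k+l+1}(a_{k+1},\dots,a_{k+l},a,a_1,\dots,a_k)\big),$$ $$\varepsilon=(|a_1|+\dots+|a_k|)(|a^*|+|a_{k+1}|+\dots+|a_{k+l}|+|a|)+|a^*|(k+l+1)+(k+1)(l+1).$$ (The lift sends a word to the signed sum of all words obtained by applying some $D_i$ to consecutive letters of $sA$, or some $D^M_{i,j}$ to consecutive letters that include the letter of $sM$.) An *$\infty$-inner-product* on $A$ is an $A_\infty$-bimodule map from $A$ to $A^*$, that is, an $R$-linear map $F:T^{sA}(sA)\to T^{sA^*}(sA)$ of degree $0$ that is compatible with the coactions and satisfies $F\circ D^A=D^{A^*}\circ F$. Let $F_{k,l}:(sA)^{\otimes k}\otimes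 sA\otimes(sA)^{\otimes l}\to sA^*$ be its components, define $f_{k,l}$ by $F_{k,l}=s\circ f_{k,l}\circ(s^{-1})^{\otimes k+l+1}$, and put $$\langle a_1,\dots,a_{k+l+1},a'\rangle_{k,l}:=f_{k,l}(a_1,\dots,a_{k+l+1})(a').$$ **Proposition.** The assignment $F\mapsto\{\langle\dots\rangle_{k,l}\}_{k,l\ge0}$ is a bijection from the set of $\infty$-inner-products on $A$ onto the set of all systems of multilinear forms $\langle\dots\rangle_{k,l}:A^{\otimes k+l+2}\to R$, $k,l\ge0$, of degree $k+l$ (the form vanishes on homogeneous arguments unless $\sum_i|a_i|+k+l=0$) which satisfy, for all $k,l\ge 0$ and all homogeneous $a_1,\dots,a_N\in A$, $N=k+l+2$, the relation $$\sum_{i=1}^{N}(-1)^{|a_1|+\dots+|a_{i-1}|}\langle a_1,\dots,\partial(a_i),\dots,a_N\rangle_{k,l}=\sum_{t,p,j}(-1)^{\eta}\,\langle b_1,\dots,b_p,m_j(b_{p+1},\dots,b_{p+j}),b_{p+j+1},\dots,b_N\rangle_{r,s}.$$ Here $(b_1,\dots,b_N)=(a_{t+1},\dots,a_N,a_1,\dots,a_t)$,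 so that the cyclic order is preserved, and the sum runs over all $0\le t<N$, $p\ge0$, $j\ge2$ with $p+j\le N$ such that $a_N=a_{k+l+2}$ is in the last slot of $\langle\dots\rangle_{r,s}$ (either as the last argument itself or inside an $m_j$ that is the last argument), and $a_{k+1}$ and $a_{k+l+2}$ are not both arguments of $m_j$. The numbers $r,s$ are determined by the condition that $a_{k+1}$ is in the $(r+1)$-th slot (by itself or inside $m_j$) and that $\langle\dots\rangle_{r,s}$ has $r+s+2=N-j+1$ arguments. The sign is given by $$\eta=(|a_1|+\dots+|a_t|)(|a_{t+1}|+\dots+|a_N|)+t(N-t)+j\,(|b_1|+\dots+|b_p|)+p(j+1)+j.$$ -/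

import Mathlib

open scoped TensorProduct DirectSum

namespace InfInner

/-- The sign `(-1)^e` in the ring `R`. -/
def sgn (R : Type*) [CommRing R] (e : ℤ) : R := ((e.negOnePow : ℤ) : R)

section TensorCoalgebra

/-! ### The tensor coalgebra `TV` and the bi-comodule `T^W V`

The underlying module of `TV = ⨁ₙ V^{⊗ n}` is Mathlib's `TensorAlgebra R V`; the word
`(v₁, …, vₙ)` is `TensorAlgebra.tprod R V n v`. -/

variable (R : Type*) [CommRing R] (V : Type*) [AddCommGroup V] [Module R V]

/-- The deconcatenation comultiplication
`Δ(v₁, …, vₙ) = ∑_{i = 0}^{n} (v₁, …, vᵢ) ⊗ (vᵢ₊₁, …, vₙ)`; see `deconc_tprod`. -/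
noncomputable def deconc :
    TensorAlgebra R V →ₗ[R] TensorAlgebra R V ⊗[R] TensorAlgebra R V :=
  (DirectSum.toModule R ℕ (TensorAlgebra R V ⊗[R] TensorAlgebra R V) fun n =>
      PiTensorProduct.lift
        (∑ i : Fin (n + 1),
          ((TensorAlgebra.tprod R V (i : ℕ)).domCoprod
            (TensorAlgebra.tprod R V (n - (i : ℕ)))).domDomCongr
              (finSumFinEquiv.trans (finCongr (by omega))))) ∘ₗ
    (TensorAlgebra.equivDirectSum (R := R) (M := V)).toLinearMap

theorem deconc_tprod (n : ℕ) (v : Fin n → V) :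
    deconc R V (TensorAlgebra.tprod R V n v) =
      ∑ i : Fin (n + 1),
        TensorAlgebra.tprod R V (i : ℕ) (fun q : Fin i => v ⟨q, by omega⟩) ⊗ₜ[R]
          TensorAlgebra.tprod R V (n - (i : ℕ))
            (fun q : Fin (n - (i : ℕ)) => v ⟨(i : ℕ) + q, by omega⟩) := by
  have h : (TensorAlgebra.equivDirectSum (R := R) (M := V)) (TensorAlgebra.tprod R V n v) =
      DirectSum.lof R ℕ (fun n => ⨂[R]^n V) n (PiTensorProduct.tprod R v) := by
    rw [DirectSum.lof_eq_of]
    exact TensorAlgebra.toDirectSum_tensorPower_tprod v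
  simp only [deconc, LinearMap.comp_apply, AlgEquiv.toLinearMap_apply, h,
    DirectSum.toModule_lof, PiTensorProduct.lift.tprod, sum_apply]
  rfl

variable (W : Type*) [AddCommGroup W] [Module R W]

/-- `T^W V = ⨁_{k,l} V^{⊗ k} ⊗ W ⊗ V^{⊗ l}`, written as `TV ⊗ W ⊗ TV`. -/
abbrev BiTensor : Type _ := TensorAlgebra R V ⊗[R] (W ⊗[R] TensorAlgebra R V)

/-- Left part of `Δ^W`: `(v₁,…,w,…,vₙ) ↦ ∑ (v₁,…,vᵢ) ⊗ (vᵢ₊₁,…,w,…,vₙ)`. -/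
noncomputable def coactL : BiTensor R V W →ₗ[R] TensorAlgebra R V ⊗[R] BiTensor R V W :=
  (TensorProduct.assoc R (TensorAlgebra R V) (TensorAlgebra R V)
      (W ⊗[R] TensorAlgebra R V)).toLinearMap ∘ₗ
    (deconc R V).rTensor (W ⊗[R] TensorAlgebra R V)

/-- Right part of `Δ^W`: `(v₁,…,w,…,vₙ) ↦ ∑ (v₁,…,w,…,vᵢ) ⊗ (vᵢ₊₁,…,vₙ)`. -/
noncomputable def coactR : BiTensor R V W →ₗ[R] BiTensor R V W ⊗[R] TensorAlgebra R V :=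
  (TensorProduct.assoc R (TensorAlgebra R V) (W ⊗[R] TensorAlgebra R V)
      (TensorAlgebra R V)).symm.toLinearMap ∘ₗ
    (((TensorProduct.assoc R W (TensorAlgebra R V) (TensorAlgebra R V)).symm.toLinearMap ∘ₗ
      (deconc R V).lTensor W).lTensor (TensorAlgebra R V))

/-- `Δ^W : T^W V → (TV ⊗ T^W V) ⊕ (T^W V ⊗ TV)`. -/
noncomputable def coact : BiTensor R V W →ₗ[R]
    (TensorAlgebra R V ⊗[R] BiTensor R V W) × (BiTensor R V W ⊗[R] TensorAlgebra R V) :=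
  (coactL R V W).prod (coactR R V W)

/-- The projection `T^W V → W`. -/
noncomputable def projW : BiTensor R V W →ₗ[R] W :=
  (TensorProduct.lid R W).toLinearMap ∘ₗ
    TensorProduct.map (TensorAlgebra.algebraMapInv (R := R) (M := V)).toLinearMap
      ((TensorProduct.rid R W).toLinearMap ∘ₗ
        (TensorAlgebra.algebraMapInv (R := R) (M := V)).toLinearMap.lTensor W)

variable {R V W}

/-- The homogeneous part of degree `d` of `TV`, for a grading `𝒱` of `V`. -/
def tensorDeg (𝒱 : ℤ → Submodule R V) (d : ℤ) : Submodule R (TensorAlgebra R V) :=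
  Submodule.span R {x | ∃ (n : ℕ) (v : Fin n → V) (e : Fin n → ℤ),
    (∀ i, v i ∈ 𝒱 (e i)) ∧ ∑ i, e i = d ∧ x = TensorAlgebra.tprod R V n v}

/-- The homogeneous part of degree `d` of `T^W V`, for gradings `𝒱` of `V` and `𝒲` of `W`. -/
def biTensorDeg (𝒱 : ℤ → Submodule R V) (𝒲 : ℤ → Submodule R W) (d : ℤ) :
    Submodule R (BiTensor R V W) :=
  Submodule.span R {x | ∃ (p q r : ℤ) (y : TensorAlgebra R V) (w : W) (z : TensorAlgebra R V),
    y ∈ tensorDeg 𝒱 p ∧ w ∈ 𝒲 q ∧ z ∈ tensorDeg 𝒱 r ∧ p + q + r = d ∧ x = y ⊗ₜ[R] (w ⊗ₜ[R] z)}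

/-- The map `(v₁, …, vₙ) ↦ (τ v₁, …, τ vₙ)` on `TV` induced by `τ : V → V`. -/
noncomputable def wordMap (τ : V →ₗ[R] V) : TensorAlgebra R V →ₐ[R] TensorAlgebra R V :=
  TensorAlgebra.lift R (TensorAlgebra.ι R ∘ₗ τ)

/-- `ψ` is an odd coderivation of `TV`: `Δ ∘ ψ = (ψ ⊗ id + id ⊗ ψ) ∘ Δ`. Here `τ` is the operator
`v ↦ (-1)^{|v|} v` on `V`; the Koszul rule `(id ⊗ ψ)(x ⊗ y) = (-1)^{|x|} x ⊗ ψ y` is expressed by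
the operator that `τ` induces on `TV`. -/
def IsOddCoderivation (τ : V →ₗ[R] V) (ψ : TensorAlgebra R V →ₗ[R] TensorAlgebra R V) : Prop :=
  deconc R V ∘ₗ ψ =
    (ψ.rTensor (TensorAlgebra R V) +
      TensorProduct.map (wordMap τ).toLinearMap ψ) ∘ₗ deconc R V

/-- The lift of a map `ρ : T^W V → W` of odd degree to `T^W V`, over an odd coderivation `ψ` of
`TV`:
`(v₁,…,w,…,vₙ) ↦ (ψ(v₁,…),w,…) + ∑ ± (v₁,…,ρ(…,w,…),…,vₙ) + ± (v₁,…,w,ψ(…,vₙ))`,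
where the signs are the Koszul signs for moving `ρ` or `ψ` past the elements to the left of it;
`τ` and `τ'` are the operators `x ↦ (-1)^{|x|} x` on `V` and `W`. -/
noncomputable def liftOdd (τ : V →ₗ[R] V) (τ' : W →ₗ[R] W)
    (ψ : TensorAlgebra R V →ₗ[R] TensorAlgebra R V) (ρ : BiTensor R V W →ₗ[R] W) :
    BiTensor R V W →ₗ[R] BiTensor R V W :=
  ψ.rTensor (W ⊗[R] TensorAlgebra R V) +
    TensorProduct.map (wordMap τ).toLinearMap (ρ.rTensor (TensorAlgebra R V)) ∘ₗ
      (coactR R V W).lTensor (TensorAlgebra R V) ∘ₗ coactL R V W +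
    TensorProduct.map (wordMap τ).toLinearMap (TensorProduct.map τ' ψ)

/-- `F : T^W V → T^Z V` (of degree `0`) is compatible with `Δ^W` and `Δ^Z`. -/
def IsComoduleMap {Z : Type*} [AddCommGroup Z] [Module R Z]
    (F : BiTensor R V W →ₗ[R] BiTensor R V Z) : Prop :=
  coact R V Z ∘ₗ F =
    ((F.lTensor (TensorAlgebra R V)).prodMap (F.rTensor (TensorAlgebra R V))) ∘ₗ coact R V W

/-- `F : T^W V → T^Z V` is a map of bimodules `(W, D^W) → (Z, D^Z)`: it has degree `0` for the
given gradings, is compatible with the coactions, and commutes with the differentials. -/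
structure IsBimoduleMap {Z : Type*} [AddCommGroup Z] [Module R Z]
    (𝒱 : ℤ → Submodule R V) (𝒲 : ℤ → Submodule R W) (𝒵 : ℤ → Submodule R Z)
    (DW : BiTensor R V W →ₗ[R] BiTensor R V W) (DZ : BiTensor R V Z →ₗ[R] BiTensor R V Z)
    (F : BiTensor R V W →ₗ[R] BiTensor R V Z) : Prop where
  degree : ∀ d : ℤ, ∀ x ∈ biTensorDeg 𝒱 𝒲 d, F x ∈ biTensorDeg 𝒱 𝒵 d
  comodule : IsComoduleMap F
  comm : F ∘ₗ DW = DZ ∘ₗ F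

end TensorCoalgebra

section AInfinity

/-! ### `A_∞`-algebras and `∞`-inner-products

`A` is a graded module with homogeneous parts `𝒜 j`. The suspension `sA` is the same module with
the shifted grading, so `s` is the identity on elements and `|sa| = |a| + 1`; the bar complex is
`BA = T(sA)`. -/

variable {R : Type*} [CommRing R] {A : Type*} [AddCommGroup A] [Module R A]

/-- The operator `a ↦ (-1)^{|a|} a`. -/
noncomputable def parity (𝒜 : ℤ → Submodule R A) [DirectSum.Decomposition 𝒜] : A →ₗ[R] A :=
  DirectSum.toModule R ℤ A (fun j => sgn R j • (𝒜 j).subtype) ∘ₗ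
    (DirectSum.decomposeLinearEquiv 𝒜).toLinearMap

/-- The grading of the suspension: `(sM)_j = M_{j-1}`. -/
def susp {M : Type*} [AddCommGroup M] [Module R M] (ℳ : ℤ → Submodule R M) :
    ℤ → Submodule R M := fun j => ℳ (j - 1)

/-- The operator `sa ↦ (-1)^{|sa|} sa = (-1)^{|a| + 1} sa` on `sA`. -/
noncomputable def suspParity (𝒜 : ℤ → Submodule R A) [DirectSum.Decomposition 𝒜] : A →ₗ[R] A :=
  -parity 𝒜

/-- The grading of `A^* = Hom_R(A, R)`: `(A^*)_j` consists of the functionals that vanish on `A_i`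
for all `i ≠ -j`. -/
def dualGrading (𝒜 : ℤ → Submodule R A) (j : ℤ) : Submodule R (Module.Dual R A) where
  carrier := {φ | ∀ i : ℤ, i ≠ -j → ∀ a ∈ 𝒜 i, φ a = 0}
  add_mem' := by
    intro φ χ hφ hχ i hi a ha
    simp [hφ i hi a ha, hχ i hi a ha]
  zero_mem' := by
    intro i _ a _
    simp
  smul_mem' := by
    intro c φ hφ i hi a ha
    simp [hφ i hi a ha]

/-- The operator `sφ ↦ (-1)^{|sφ|} sφ = (-1)^{|φ| + 1} sφ` on `sA^*`. -/
noncomputable def suspParityDual (𝒜 : ℤ → Submodule R A) [DirectSum.Decomposition 𝒜] :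
    Module.Dual R A →ₗ[R] Module.Dual R A :=
  -(parity 𝒜).dualMap

/-- An `A_∞`-algebra structure on `A`: a coderivation `D` of degree `-1` on `BA = T(sA)` with
`D² = 0`, whose component `D₀ : R → sA` vanishes. -/
structure IsAInfinityAlgebra (𝒜 : ℤ → Submodule R A) [DirectSum.Decomposition 𝒜]
    (D : TensorAlgebra R A →ₗ[R] TensorAlgebra R A) : Prop where
  degree : ∀ d : ℤ, ∀ x ∈ tensorDeg (susp 𝒜) d, D x ∈ tensorDeg (susp 𝒜) (d - 1)
  coderivation : IsOddCoderivation (suspParity 𝒜) D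
  square_zero : D ∘ₗ D = 0
  zero_comp : TensorAlgebra.ιInv (D 1) = 0

/-- The operations `m_n : A^{⊗ n} → A` determined by `D_n = s ∘ m_n ∘ (s⁻¹)^{⊗ n}`, where `D_n` is
the component `(sA)^{⊗ n} → sA` of `D`. By the Koszul rule,
`m_n(a₁, …, aₙ) = (-1)^{∑ᵢ (n-i)(|aᵢ|+1)} D_n(sa₁, …, saₙ)`. -/
noncomputable def mulOp (𝒜 : ℤ → Submodule R A) [DirectSum.Decomposition 𝒜]
    (D : TensorAlgebra R A →ₗ[R] TensorAlgebra R A) (n : ℕ) (a : Fin n → A) : A :=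
  TensorAlgebra.ιInv (D (TensorAlgebra.tprod R A n
    (fun i => (suspParity 𝒜 ^ (n - 1 - (i : ℕ))) (a i))))

/-- The components `D^A_{k,l} = D_{k+l+1}` of the canonical bimodule structure on `A`:
`(x₁, …, x_k) ⊗ y ⊗ (x_{k+1}, …, x_{k+l}) ↦ D_{k+l+1}(x₁, …, x_k, y, x_{k+1}, …, x_{k+l})`. -/
noncomputable def selfComponent (D : TensorAlgebra R A →ₗ[R] TensorAlgebra R A) :
    BiTensor R A A →ₗ[R] A :=
  TensorAlgebra.ιInv ∘ₗ D ∘ₗ LinearMap.mul' R (TensorAlgebra R A) ∘ₗ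
    (LinearMap.mul' R (TensorAlgebra R A) ∘ₗ
      (TensorAlgebra.ι R (M := A)).rTensor (TensorAlgebra R A)).lTensor (TensorAlgebra R A)

/-- The differential `D^A` on `B^A A = T^{sA}(sA)`. -/
noncomputable def selfD (𝒜 : ℤ → Submodule R A) [DirectSum.Decomposition 𝒜]
    (D : TensorAlgebra R A →ₗ[R] TensorAlgebra R A) : BiTensor R A A →ₗ[R] BiTensor R A A :=
  liftOdd (suspParity 𝒜) (suspParity 𝒜) D (selfComponent D)

/-- The endomorphism `a ↦ (-1)^{|a|} pr_{sA} D(y, a, x)` of `A`, for words `x` and `y`. -/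
noncomputable def wrapOp (𝒜 : ℤ → Submodule R A) [DirectSum.Decomposition 𝒜]
    (D : TensorAlgebra R A →ₗ[R] TensorAlgebra R A) (x y : TensorAlgebra R A) : A →ₗ[R] A :=
  TensorAlgebra.ιInv ∘ₗ D ∘ₗ LinearMap.mulRight R x ∘ₗ LinearMap.mulLeft R y ∘ₗ
    TensorAlgebra.ι R ∘ₗ parity 𝒜

/-- The components `D^{A^*}_{k,l}` of the canonical bimodule structure on `A^*`: for words `x` of
length `k` and `y` of length `l`, `D^{A^*}_{k,l}(x, sφ, y) = s χ` with
`χ(a) = (-1)^{|a|} φ(s⁻¹ D_{k+l+1}(y, sa, x))`.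
In terms of `m_n` this is the map
`c_{k,l}(a₁,…,a_k,φ,a_{k+1},…,a_{k+l})(a) = ± φ(m_{k+l+1}(a_{k+1},…,a_{k+l},a,a₁,…,a_k))` with sign
exponent `(|a₁|+…+|a_k|)(|φ|+|a_{k+1}|+…+|a_{k+l}|+|a|) + |φ|(k+l+1) + (k+1)(l+1)`. -/
noncomputable def dualComponent (𝒜 : ℤ → Submodule R A) [DirectSum.Decomposition 𝒜]
    (D : TensorAlgebra R A →ₗ[R] TensorAlgebra R A) :
    BiTensor R A (Module.Dual R A) →ₗ[R] Module.Dual R A :=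
  TensorProduct.lift
    { toFun := fun x => TensorProduct.lift
        (LinearMap.mk₂ R (fun (φ : Module.Dual R A) y => φ ∘ₗ wrapOp 𝒜 D x y)
          (by intros; ext; simp) (by intros; ext; simp)
          (by intros; ext; simp [wrapOp, add_mul]) (by intros; ext; simp [wrapOp]))
      map_add' := by intros; ext; simp [wrapOp, mul_add]
      map_smul' := by intros; ext; simp [wrapOp] }

/-- The differential `D^{A^*}` on `B^{A^*} A = T^{sA^*}(sA)`. -/
noncomputable def dualD (𝒜 : ℤ → Submodule R A) [DirectSum.Decomposition 𝒜]
    (D : TensorAlgebra R A →ₗ[R] TensorAlgebra R A) :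
    BiTensor R A (Module.Dual R A) →ₗ[R] BiTensor R A (Module.Dual R A) :=
  liftOdd (suspParity 𝒜) (suspParityDual 𝒜) D (dualComponent 𝒜 D)

/-- An `∞`-inner-product on `(A, D)`: an `A_∞`-bimodule-map from `A` to `A^*`. -/
def IsInfinityInnerProduct (𝒜 : ℤ → Submodule R A) [DirectSum.Decomposition 𝒜]
    (D : TensorAlgebra R A →ₗ[R] TensorAlgebra R A)
    (F : BiTensor R A A →ₗ[R] BiTensor R A (Module.Dual R A)) : Prop :=
  IsBimoduleMap (susp 𝒜) (susp 𝒜) (susp (dualGrading 𝒜)) (selfD 𝒜 D) (dualD 𝒜 D) F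

/-- `⟨a₁, …, a_{k+l+1}, a'⟩_{k,l} = f_{k,l}(a₁, …, a_{k+l+1})(a')`, where
`F_{k,l} = s ∘ f_{k,l} ∘ (s⁻¹)^{⊗ k+l+1}` and `F_{k,l}` is the component
`(sA)^{⊗ k} ⊗ sA ⊗ (sA)^{⊗ l} → sA^*` of `F`. By the Koszul rule, `f_{k,l}` and `F_{k,l}` differ by
the sign `(-1)^{∑ᵢ (k+l+1-i)(|aᵢ|+1)}`. -/
noncomputable def formOf (𝒜 : ℤ → Submodule R A) [DirectSum.Decomposition 𝒜]
    (F : BiTensor R A A →ₗ[R] BiTensor R A (Module.Dual R A)) (k l : ℕ)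
    (a : Fin (k + l + 2) → A) : R :=
  projW R A (Module.Dual R A)
    (F (TensorAlgebra.tprod R A k
          (fun i : Fin k => (suspParity 𝒜 ^ (k + l - (i : ℕ))) (a ⟨i, by omega⟩)) ⊗ₜ[R]
        ((suspParity 𝒜 ^ l) (a ⟨k, by omega⟩) ⊗ₜ[R]
          TensorAlgebra.tprod R A l
            (fun i : Fin l => (suspParity 𝒜 ^ (l - 1 - (i : ℕ))) (a ⟨k + 1 + i, by omega⟩)))))
    (a ⟨k + l + 1, by omega⟩)

end AInfinity

section Systems

/-! ### Systems of inner products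

Positions of arguments are counted from `0`, so that for a form `⟨…⟩_{k,l}` with `N = k + l + 2`
arguments the special arguments `a_{k+1}` and `a_{k+l+2}` have positions `k` and `N - 1`. -/

/-- A system of multilinear forms `⟨…⟩_{k,l} : A^{⊗ k+l+2} → R`. -/
abbrev FormSystem (R : Type*) [CommRing R] (A : Type*) [AddCommGroup A] [Module R A] : Type _ :=
  ∀ k l : ℕ, MultilinearMap R (fun _ : Fin (k + l + 2) => A) R

/-- The `q`-th entry (cyclically, counted from `0`) of the rotated sequence
`a_{t+1}, …, a_N, a₁, …, a_t`, where `N = n + 2`. -/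
def rot {α : Type*} {n : ℕ} (a : Fin (n + 2) → α) (t q : ℕ) : α :=
  a ⟨(t + q) % (n + 2), Nat.mod_lt _ (by omega)⟩

/-- The slot in which position `q` ends up when `m_j` is applied to the positions
`p, …, p + j - 1`. -/
def slot (p j q : ℕ) : ℕ := if q < p then q else if q < p + j then p else q - (j - 1)

/-- The slot of `a_{k+l+2}`, after rotating by `t` and inserting `m_j` at position `p`. -/
def lastSlot (k l t p j : ℕ) : ℕ := slot p j (k + l + 1 - t)

/-- The slot of `a_{k+1}`, after rotating by `t` and inserting `m_j` at position `p`. -/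
def specialSlot (k l t p j : ℕ) : ℕ := slot p j ((k + (k + l + 2 - t)) % (k + l + 2))

/-- The terms on the right hand side: the cyclic rotation starts with `a_{t+1}`, and `m_j` with
`j ≥ 2` is applied to the `j` consecutive arguments from position `p` on (so that the resulting
inner product has `k + l + 3 - j` arguments), such that `a_{k+l+2}` is in the last slot and is not
in the same slot as `a_{k+1}`. -/
def Admissible (k l t p j : ℕ) : Prop :=
  2 ≤ j ∧ p + j ≤ k + l + 2 ∧ lastSlot k l t p j = k + l + 2 - j ∧
    specialSlot k l t p j ≠ lastSlot k l t p j

instance (k l t p j : ℕ) : Decidable (Admissible k l t p j) := by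
  unfold Admissible; infer_instance

/-- The exponent of the sign of a term, for arguments `a_i` of degrees `d_i`. With `N = k + l + 2`
and `b` the rotated sequence of degrees it is
`(d₁+…+d_t)(d_{t+1}+…+d_N) + t(N-t) + j (b₁+…+b_p) + p(j+1) + j`. -/
def signExp (k l t p j : ℕ) (d : Fin (k + l + 2) → ℤ) : ℤ :=
  (∑ i : Fin (k + l + 2), if (i : ℕ) < t then d i else 0) *
      (∑ i : Fin (k + l + 2), if (i : ℕ) < t then 0 else d i) +
    (t : ℤ) * ((k : ℤ) + l + 2 - t) +
    (j : ℤ) * (∑ q ∈ Finset.range p, rot d t q) + (p : ℤ) * (j + 1) + j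

variable {R : Type*} [CommRing R] {A : Type*} [AddCommGroup A] [Module R A]

/-- The arguments of a term: `m_j` is applied to the positions `p, …, p + j - 1` of the sequence
`a_{t+1}, …, a_N, a₁, …, a_t`. -/
noncomputable def insertArgs (𝒜 : ℤ → Submodule R A) [DirectSum.Decomposition 𝒜]
    (D : TensorAlgebra R A →ₗ[R] TensorAlgebra R A) {n : ℕ} (a : Fin (n + 2) → A)
    (t p j q : ℕ) : A :=
  if q < p then rot a t q
  else if q = p then mulOp 𝒜 D j (fun i => rot a t (p + i))
  else rot a t (q + (j - 1))

/-- The term `⟨a_{t+1}, …, m_j(…), …⟩_{r,s}`, in which `a_{k+1}` is in the `(r+1)`-th slot and there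
are `r + s + 2 = k + l + 3 - j` arguments. -/
noncomputable def insertTerm (𝒜 : ℤ → Submodule R A) [DirectSum.Decomposition 𝒜]
    (D : TensorAlgebra R A →ₗ[R] TensorAlgebra R A) (form : FormSystem R A) (k l : ℕ)
    (a : Fin (k + l + 2) → A) (t p j : ℕ) : R :=
  form (specialSlot k l t p j) (k + l + 1 - j - specialSlot k l t p j)
    (fun q => insertArgs 𝒜 D a t p j q)

/-- The systems of inner products on `(A, D)`: `⟨…⟩_{k,l}` has degree `k + l` (it vanishes on
homogeneous arguments unless their degrees sum to `-(k+l)`), and the relation between the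
`m₁`-terms and the terms with exactly one `m_j`, `j ≥ 2`, holds on homogeneous arguments. -/
structure IsInnerProductSystem (𝒜 : ℤ → Submodule R A) [DirectSum.Decomposition 𝒜]
    (D : TensorAlgebra R A →ₗ[R] TensorAlgebra R A) (form : FormSystem R A) : Prop where
  degree : ∀ (k l : ℕ) (a : Fin (k + l + 2) → A) (d : Fin (k + l + 2) → ℤ),
    (∀ i, a i ∈ 𝒜 (d i)) → ∑ i, d i + k + l ≠ 0 → form k l a = 0
  relation : ∀ (k l : ℕ) (a : Fin (k + l + 2) → A) (d : Fin (k + l + 2) → ℤ),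
    (∀ i, a i ∈ 𝒜 (d i)) →
      ∑ i : Fin (k + l + 2), sgn R (∑ j ∈ Finset.univ.filter (· < i), d j) *
          form k l (Function.update a i (mulOp 𝒜 D 1 (fun _ => a i))) =
        ∑ t ∈ Finset.range (k + l + 2), ∑ p ∈ Finset.range (k + l + 2),
          ∑ j ∈ Finset.Icc 2 (k + l + 2),
            if Admissible k l t p j then
              sgn R (signExp k l t p j d) * insertTerm 𝒜 D form k l a t p j
            else 0

end Systems

end InfInner

/-! The bicomodule `T^W V` is cofree. A map `F` compatible with the coactions is determined by its
corestriction `ρ = projW ∘ F`, and every `ρ` occurs, as the corestriction of `coextend LinearMap.id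
ρ` (`IsComoduleMap.eq_coextend`, `projW_comp_coextend`). The defect `F ∘ D^A - D^{A^*} ∘ F` is also
determined by its corestriction, because the terms in which `D` acts on the outer tensor factor
cancel (`IsComoduleMap.comm_of_projW`). So the bimodule equation amounts to one identity of maps
into `A^*`, namely `dualComponent ∘ coextend id ρ = ρ ∘ selfD`.

Evaluate this identity on homogeneous `a_1, …, a_{N-1}` and the result on `a_N`. The side `ρ ∘
selfD` gives one term for each block of consecutive letters among `a_1, …, a_{N-1}`
(`apply_selfD_word`). The dual side gives one term for each cyclic block that contains `a_N` but not
`a_{k+1}` (`apply_dualComponent_coextend_word`). Together these are the admissible terms with `j ≥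
2` and the blocks of length one, which are the `∂`-terms (`sum_admissible`). Hence the two sides of
the relation differ, up to one common sign, by the difference of the two sides of the identity
(`relation_sub`).

The signs between `m_n`, `f_{k,l}` and `D_n`, `F_{k,l}` are desuspension signs, with exponents given
by `weight`. Comparing them comes down to two identities in `ZMod 2`. The one for blocks through
`a_N` uses the parity of the total degree; in all other degrees the term vanishes.

Finally, the desuspension signs form an involution, and a system of multilinear forms is the same as
a map `ρ` (`exists_formEval_eq`), so passing to components loses nothing and reaches every system.
-/

namespace InfInner

/-! ### Signs and their reduction modulo 2 -/

section Signs

variable {R : Type*} [CommRing R]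

theorem sgn_add (e f : ℤ) : sgn R (e + f) = sgn R e * sgn R f := by
  simp [sgn, Int.negOnePow_add]

@[simp] theorem sgn_zero : sgn R 0 = 1 := by simp [sgn]

theorem sgn_one : sgn R 1 = -1 := by simp [sgn]

/-- Moves every comparison of signs into `ZMod 2`, where `decide` and `linear_combination` apply. -/
theorem sgn_congr {e f : ℤ} (h : (e : ZMod 2) = f) : sgn R e = sgn R f := by
  have : e.negOnePow = f.negOnePow := by
    rw [Int.negOnePow_eq_iff, even_iff_two_dvd]
    exact_mod_cast (ZMod.intCast_eq_intCast_iff_dvd_sub f e 2).1 h.symm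
  simp [sgn, this]

@[simp] theorem sgn_mul_self (e : ℤ) : sgn R e * sgn R e = 1 := by
  rw [← sgn_add, ← sgn_zero (R := R)]
  refine sgn_congr ?_
  push_cast
  exact CharTwo.add_self_eq_zero _

theorem sgn_natMul (m : ℕ) (e : ℤ) : sgn R (m * e) = sgn R e ^ m := by
  induction m with
  | zero => simp
  | succ m ih => rw [pow_succ, ← ih, ← sgn_add]; push_cast; ring_nf

end Signs

/-! ### Words spanning `TV` and `T^W V` -/

section Words

variable {R : Type*} [CommRing R] {V : Type*} [AddCommGroup V] [Module R V]

variable (R) in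
/-- The word `(a_s, …, a_{s+n-1})` in `TV`. -/
noncomputable def word (a : ℕ → V) (s n : ℕ) : TensorAlgebra R V :=
  TensorAlgebra.tprod R V n (fun i => a (s + i))

theorem word_congr {a b : ℕ → V} {s s' n : ℕ} (h : ∀ i < n, a (s + i) = b (s' + i)) :
    word R a s n = word R b s' n := by
  unfold word
  congr 1
  funext i
  exact h i i.2

@[simp] theorem word_zero (a : ℕ → V) (s : ℕ) : word R a s 0 = 1 := by
  simp [word, TensorAlgebra.tprod_apply]

theorem word_succ (a : ℕ → V) (s n : ℕ) :
    word R a s (n + 1) = TensorAlgebra.ι R (a s) * word R a (s + 1) n := by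
  simp [word, TensorAlgebra.tprod_apply, List.ofFn_succ, add_comm, add_left_comm]

@[simp] theorem word_one (a : ℕ → V) (s : ℕ) : word R a s 1 = TensorAlgebra.ι R (a s) := by
  simp [word_succ]

theorem word_add (a : ℕ → V) (s m n : ℕ) :
    word R a s (m + n) = word R a s m * word R a (s + m) n := by
  induction m generalizing s with
  | zero => simp
  | succ m ih =>
    rw [show m + 1 + n = (m + n) + 1 by omega, word_succ, ih, word_succ, mul_assoc,
      show s + 1 + m = s + (m + 1) by omega]

theorem word_succ' (a : ℕ → V) (s n : ℕ) :
    word R a s (n + 1) = word R a s n * TensorAlgebra.ι R (a (s + n)) := by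
  simp [word_add]

theorem wordMap_word (τ : V →ₗ[R] V) (a : ℕ → V) (s n : ℕ) :
    wordMap τ (word R a s n) = word R (fun q => τ (a q)) s n := by
  induction n generalizing s with
  | zero => simp
  | succ n ih => rw [word_succ, map_mul, ih, word_succ]; simp [wordMap]

theorem algebraMapInv_word (a : ℕ → V) (s n : ℕ) :
    TensorAlgebra.algebraMapInv (word R a s n) = if n = 0 then (1 : R) else 0 := by
  cases n with
  | zero => simp
  | succ n => simp [word_succ, TensorAlgebra.algebraMapInv]

theorem ιInv_one : TensorAlgebra.ιInv (1 : TensorAlgebra R V) = 0 := by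
  -- `ιInv` is the second component of `toTrivSqZeroExt` for exactly this right action, so the final
  -- `congrArg` holds by unfolding.
  let : Module Rᵐᵒᵖ V := Module.compHom _ ((RingHom.id R).fromOpposite mul_comm)
  have : IsCentralScalar R V := ⟨fun r m => rfl⟩
  have h : TensorAlgebra.toTrivSqZeroExt (1 : TensorAlgebra R V) = 1 := map_one _
  exact congrArg TrivSqZeroExt.snd h

theorem ιInv_word (a : ℕ → V) (s n : ℕ) :
    TensorAlgebra.ιInv (word R a s n) = if n = 1 then a s else 0 := by
  match n with
  | 0 => simp [ιInv_one]
  | 1 => simp [TensorAlgebra.ι_leftInverse (R := R) (a s)]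
  | n + 2 =>
    simp only [word_succ, TensorAlgebra.ιInv]
    simp
    exact zero_smul R _

theorem deconc_word (a : ℕ → V) (s n : ℕ) :
    deconc R V (word R a s n) =
      ∑ i ∈ Finset.range (n + 1), word R a s i ⊗ₜ[R] word R a (s + i) (n - i) := by
  rw [word, deconc_tprod, Finset.sum_range]
  simp [word, add_assoc]

/-- Words with letters in a spanning set span `TV`. -/
theorem span_word (S : Set V) (hS : Submodule.span R S = ⊤) :
    Submodule.span R {x | ∃ (a : ℕ → V) (n : ℕ), (∀ q, a q ∈ S ∪ {0}) ∧ x = word R a 0 n} = ⊤ := by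
  set P := Submodule.span R {x | ∃ (a : ℕ → V) (n : ℕ), (∀ q, a q ∈ S ∪ {0}) ∧ x = word R a 0 n}
  -- A word reads only finitely many letters of an infinite sequence; the letter `0` fills the rest,
  -- which matters when `S` is empty.
  have hone : (1 : TensorAlgebra R V) ∈ P :=
    Submodule.subset_span ⟨fun _ => 0, 0, by simp, by simp⟩
  refine Submodule.eq_top_iff'.2 fun x => ?_
  induction x using TensorAlgebra.induction with
  | algebraMap r => rw [Algebra.algebraMap_eq_smul_one]; exact P.smul_mem r hone
  | ι v =>
    have hv : v ∈ Submodule.span R S := by rw [hS]; trivial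
    have : Submodule.span R S ≤ P.comap (TensorAlgebra.ι R) := by
      refine Submodule.span_le.2 fun v hv => ?_
      exact Submodule.subset_span ⟨fun _ => v, 1, by simp [hv], by simp⟩
    exact this hv
  | mul x y hx hy =>
    have : P * P ≤ P := by
      rw [Submodule.span_mul_span]
      refine Submodule.span_mono ?_
      rintro _ ⟨_, ⟨a, m, ha, rfl⟩, _, ⟨b, n, hb, rfl⟩, rfl⟩
      refine ⟨fun q => if q < m then a q else b (q - m), m + n, ?_, ?_⟩
      · intro q
        dsimp only
        split_ifs
        exacts [ha _, hb _]
      · rw [word_add]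
        dsimp only
        congr 1
        · exact word_congr fun i hi => by simp [hi]
        · exact word_congr fun i _ => by simp
    exact this (Submodule.mul_mem_mul hx hy)
  | add x y hx hy => exact P.add_mem hx hy

variable {M : Type*} [AddCommMonoid M] [Module R M]

theorem word_ext_of_span (S : Set V) (hS : Submodule.span R S = ⊤)
    {f g : TensorAlgebra R V →ₗ[R] M}
    (h : ∀ (a : ℕ → V) (n : ℕ), (∀ q, a q ∈ S ∪ {0}) → f (word R a 0 n) = g (word R a 0 n)) :
    f = g :=
  LinearMap.ext_on (span_word S hS) (by rintro _ ⟨a, n, ha, rfl⟩; exact h a n ha)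

theorem word_ext {f g : TensorAlgebra R V →ₗ[R] M}
    (h : ∀ (a : ℕ → V) (n : ℕ), f (word R a 0 n) = g (word R a 0 n)) : f = g :=
  word_ext_of_span Set.univ Submodule.span_univ fun a n _ => h a n

variable {W : Type*} [AddCommGroup W] [Module R W]

theorem biWord_ext_of_span (S : Set V) (hS : Submodule.span R S = ⊤) (S' : Set W)
    (hS' : Submodule.span R S' = ⊤) {f g : BiTensor R V W →ₗ[R] M}
    (h : ∀ (a : ℕ → V) (k : ℕ) (w : W) (b : ℕ → V) (l : ℕ), (∀ q, a q ∈ S ∪ {0}) → w ∈ S' →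
      (∀ q, b q ∈ S ∪ {0}) →
        f (word R a 0 k ⊗ₜ (w ⊗ₜ word R b 0 l)) = g (word R a 0 k ⊗ₜ (w ⊗ₜ word R b 0 l))) :
    f = g := by
  refine TensorProduct.ext (word_ext_of_span S hS fun a k ha => TensorProduct.ext ?_)
  refine LinearMap.ext_on hS' fun w hw => word_ext_of_span S hS fun b l hb => ?_
  exact h a k w b l ha hw hb

theorem biWord_ext {f g : BiTensor R V W →ₗ[R] M}
    (h : ∀ (a : ℕ → V) (k : ℕ) (w : W) (b : ℕ → V) (l : ℕ),
        f (word R a 0 k ⊗ₜ (w ⊗ₜ word R b 0 l)) = g (word R a 0 k ⊗ₜ (w ⊗ₜ word R b 0 l))) :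
    f = g :=
  biWord_ext_of_span Set.univ Submodule.span_univ Set.univ Submodule.span_univ
    fun a k w b l _ _ _ => h a k w b l

theorem wordMap_id : wordMap (LinearMap.id : V →ₗ[R] V) = AlgHom.id R _ := by
  ext; simp [wordMap]

end Words

/-! ### Parity operators on homogeneous elements -/

section Gradings

variable {R : Type*} [CommRing R] {A : Type*} [AddCommGroup A] [Module R A]
  (𝒜 : ℤ → Submodule R A) [DirectSum.Decomposition 𝒜]

theorem parity_of_mem {d : ℤ} {a : A} (ha : a ∈ 𝒜 d) : parity 𝒜 a = sgn R d • a := by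
  simp only [parity, LinearMap.comp_apply, LinearEquiv.coe_coe,
    DirectSum.decomposeLinearEquiv_apply, DirectSum.decompose_of_mem 𝒜 ha]
  rw [← DirectSum.lof_eq_of R, DirectSum.toModule_lof]
  simp

theorem suspParity_of_mem {d : ℤ} {a : A} (ha : a ∈ 𝒜 d) :
    suspParity 𝒜 a = sgn R (d + 1) • a := by
  simp [suspParity, parity_of_mem 𝒜 ha, sgn_add, sgn_one]

theorem suspParity_pow_of_mem {d : ℤ} {a : A} (ha : a ∈ 𝒜 d) (m : ℕ) :
    (suspParity 𝒜 ^ m) a = sgn R (m * (d + 1)) • a := by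
  induction m with
  | zero => simp
  | succ m ih =>
    rw [pow_succ', Module.End.mul_apply, ih, map_smul, suspParity_of_mem 𝒜 ha, smul_smul, sgn_natMul,
      sgn_natMul, pow_succ]

theorem span_homogeneous : Submodule.span R {a | ∃ d, a ∈ 𝒜 d} = ⊤ := by
  refine Submodule.eq_top_iff'.2 fun a => ?_
  induction a using DirectSum.Decomposition.inductionOn 𝒜 with
  | zero => exact Submodule.zero_mem _
  | homogeneous a => exact Submodule.subset_span ⟨_, a.2⟩
  | add a b ha hb => exact Submodule.add_mem _ ha hb

theorem suspParity_mul_self : suspParity 𝒜 * suspParity 𝒜 = 1 := by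
  refine LinearMap.ext_on (span_homogeneous 𝒜) ?_
  rintro a ⟨d, ha⟩
  simp [suspParity_of_mem 𝒜 ha, smul_smul]

/-- Desuspension signs undo themselves; both injectivity and surjectivity of the final
correspondence rest on this. -/
theorem suspParity_pow_apply_self (m : ℕ) (a : A) :
    (suspParity 𝒜 ^ m) ((suspParity 𝒜 ^ m) a) = a := by
  rw [← Module.End.mul_apply, ← (Commute.refl (suspParity 𝒜)).mul_pow, suspParity_mul_self,
    one_pow, Module.End.one_apply]

end Gradings

/-! ### Cofreeness of the bicomodule `T^W V` -/

section Coextension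

variable {R : Type*} [CommRing R] {V : Type*} [AddCommGroup V] [Module R V]
  {W : Type*} [AddCommGroup W] [Module R W] {Z : Type*} [AddCommGroup Z] [Module R Z]

theorem coactL_word (a : ℕ → V) (s k : ℕ) (z : W ⊗[R] TensorAlgebra R V) :
    coactL R V W (word R a s k ⊗ₜ z) =
      ∑ i ∈ Finset.range (k + 1), word R a s i ⊗ₜ (word R a (s + i) (k - i) ⊗ₜ z) := by
  simp [coactL, deconc_word, TensorProduct.sum_tmul]

theorem coactR_word (x : TensorAlgebra R V) (w : W) (b : ℕ → V) (s l : ℕ) :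
    coactR R V W (x ⊗ₜ (w ⊗ₜ word R b s l)) =
      ∑ m ∈ Finset.range (l + 1), (x ⊗ₜ (w ⊗ₜ word R b s m)) ⊗ₜ word R b (s + m) (l - m) := by
  simp [coactR, deconc_word, TensorProduct.tmul_sum]

theorem projW_word (a : ℕ → V) (s k : ℕ) (w : W) (b : ℕ → V) (s' l : ℕ) :
    projW R V W (word R a s k ⊗ₜ (w ⊗ₜ word R b s' l)) = if k = 0 ∧ l = 0 then w else 0 := by
  simp only [projW, LinearMap.comp_apply, TensorProduct.map_tmul, AlgHom.toLinearMap_apply,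
    LinearMap.lTensor_tmul, algebraMapInv_word, LinearEquiv.coe_coe, TensorProduct.lid_tmul,
    TensorProduct.rid_tmul]
  split_ifs <;> simp_all

/-- The extension of `ρ : T^W V → Z` to
`(v₁,…,w,…,vₙ) ↦ ∑ (τ v₁,…,τ vᵢ, ρ(vᵢ₊₁,…,w,…,vⱼ), vⱼ₊₁,…,vₙ)`. -/
noncomputable def coextend (τ : V →ₗ[R] V) (ρ : BiTensor R V W →ₗ[R] Z) :
    BiTensor R V W →ₗ[R] BiTensor R V Z :=
  TensorProduct.map (wordMap τ).toLinearMap (ρ.rTensor (TensorAlgebra R V)) ∘ₗ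
      (coactR R V W).lTensor (TensorAlgebra R V) ∘ₗ coactL R V W

theorem coextend_word (τ : V →ₗ[R] V) (ρ : BiTensor R V W →ₗ[R] Z) (a : ℕ → V) (s k : ℕ) (w : W)
    (b : ℕ → V) (s' l : ℕ) :
    coextend τ ρ (word R a s k ⊗ₜ (w ⊗ₜ word R b s' l)) =
      ∑ i ∈ Finset.range (k + 1), ∑ m ∈ Finset.range (l + 1),
        word R (fun q => τ (a q)) s i ⊗ₜ
          (ρ (word R a (s + i) (k - i) ⊗ₜ (w ⊗ₜ word R b s' m)) ⊗ₜ word R b (s' + m) (l - m)) := by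
  simp only [coextend, LinearMap.comp_apply, coactL_word, map_sum, LinearMap.lTensor_tmul,
    coactR_word, TensorProduct.map_tmul, LinearMap.rTensor_tmul, TensorProduct.tmul_sum,
    AlgHom.toLinearMap_apply, wordMap_word]

theorem sum_range_triangle {M : Type*} [AddCommMonoid M] (f : ℕ → ℕ → M) (n : ℕ) :
    ∑ i ∈ Finset.range (n + 1), ∑ j ∈ Finset.range (i + 1), f j (i - j) =
      ∑ i ∈ Finset.range (n + 1), ∑ j ∈ Finset.range (n - i + 1), f i j := by
  rw [Finset.sum_range_diag_flip]
  refine Finset.sum_congr rfl fun i hi => ?_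
  rw [Nat.sub_add_comm (by simpa [Nat.lt_succ_iff] using hi)]

/-- Coassociativity: both sides cut the letters left of `w` in two places, and `sum_range_triangle`
matches the two orders of cutting. The letters in the outer factor also lie to the left of `ρ`,
hence the twist by `τ`. -/
theorem coactL_comp_coextend (τ : V →ₗ[R] V) (ρ : BiTensor R V W →ₗ[R] Z) :
    coactL R V Z ∘ₗ coextend τ ρ =
      TensorProduct.map (wordMap τ).toLinearMap (coextend τ ρ) ∘ₗ coactL R V W := by
  refine biWord_ext fun a k w b l => ?_
  simp only [LinearMap.comp_apply, coactL_word, map_sum, TensorProduct.map_tmul, coextend_word,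
    AlgHom.toLinearMap_apply, wordMap_word, TensorProduct.tmul_sum]
  rw [← sum_range_triangle (fun i j => ∑ m ∈ Finset.range (l + 1),
    word R (fun q => τ (a q)) 0 i ⊗ₜ[R] (word R (fun q => τ (a q)) (0 + i) j ⊗ₜ[R]
      (ρ (word R a (0 + i + j) (k - i - j) ⊗ₜ[R] (w ⊗ₜ[R] word R b 0 m)) ⊗ₜ[R]
        word R b (0 + m) (l - m)))) k]
  refine Finset.sum_congr rfl fun i hi => ?_
  rw [Finset.sum_comm]
  refine Finset.sum_congr rfl fun j hj => Finset.sum_congr rfl fun m _ => ?_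
  have : j ≤ i := by simpa [Nat.lt_succ_iff] using hj
  rw [show 0 + j + (i - j) = 0 + i by omega, show k - j - (i - j) = k - i by omega]

theorem coactR_comp_coextend (τ : V →ₗ[R] V) (ρ : BiTensor R V W →ₗ[R] Z) :
    coactR R V Z ∘ₗ coextend τ ρ =
      (coextend τ ρ).rTensor (TensorAlgebra R V) ∘ₗ coactR R V W := by
  refine biWord_ext fun a k w b l => ?_
  simp only [LinearMap.comp_apply, coactR_word, map_sum, LinearMap.rTensor_tmul, coextend_word,
    TensorProduct.sum_tmul]
  rw [Finset.sum_comm (s := Finset.range (l + 1))]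
  refine Finset.sum_congr rfl fun i _ => ?_
  rw [← sum_range_triangle (fun m j =>
    (word R (fun q => τ (a q)) 0 i ⊗ₜ[R]
      (ρ (word R a (0 + i) (k - i) ⊗ₜ[R] (w ⊗ₜ[R] word R b 0 m)) ⊗ₜ[R]
        word R b (0 + m) j)) ⊗ₜ[R] word R b (0 + m + j) (l - m - j)) l]
  refine Finset.sum_congr rfl fun m hm => Finset.sum_congr rfl fun j hj => ?_
  have : j ≤ m := by simpa [Nat.lt_succ_iff] using hj
  rw [show 0 + j + (m - j) = 0 + m by omega, show l - j - (m - j) = l - m by omega]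

theorem coextend_id_projW : coextend LinearMap.id (projW R V W) = LinearMap.id := by
  refine biWord_ext fun a k w b l => ?_
  simp only [coextend_word, projW_word, LinearMap.id_apply]
  rw [Finset.sum_eq_single k, Finset.sum_eq_single 0]
  · simp
  · intro m _ hm; simp [hm]
  · simp
  · intro i hi hik
    have : k - i ≠ 0 := by simp at hi; omega
    simp [this]
  · simp

theorem projW_comp_coextend (τ : V →ₗ[R] V) (ρ : BiTensor R V W →ₗ[R] Z) :
    projW R V Z ∘ₗ coextend τ ρ = ρ := by
  refine biWord_ext fun a k w b l => ?_
  simp only [LinearMap.comp_apply, coextend_word, map_sum, projW_word]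
  rw [Finset.sum_eq_single 0, Finset.sum_eq_single l]
  · simp
  · intro m hm hml
    have : l - m ≠ 0 := by simp at hm; omega
    simp [this]
  · simp
  · intro i hi hik
    simp [hik]
  · simp

theorem isComoduleMap_iff {F : BiTensor R V W →ₗ[R] BiTensor R V Z} :
    IsComoduleMap F ↔ coactL R V Z ∘ₗ F = F.lTensor (TensorAlgebra R V) ∘ₗ coactL R V W ∧
      coactR R V Z ∘ₗ F = F.rTensor (TensorAlgebra R V) ∘ₗ coactR R V W := by
  constructor
  · intro h
    exact ⟨LinearMap.ext fun x => congrArg Prod.fst (LinearMap.congr_fun h x),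
      LinearMap.ext fun x => congrArg Prod.snd (LinearMap.congr_fun h x)⟩
  · rintro ⟨h₁, h₂⟩
    exact LinearMap.ext fun x =>
      Prod.ext (LinearMap.congr_fun h₁ x) (LinearMap.congr_fun h₂ x)

theorem isComoduleMap_coextend (ρ : BiTensor R V W →ₗ[R] Z) :
    IsComoduleMap (coextend LinearMap.id ρ) := by
  refine isComoduleMap_iff.2 ⟨?_, coactR_comp_coextend _ _⟩
  rw [coactL_comp_coextend, wordMap_id]
  rfl

/-- Cofreeness, with an arbitrary `P` on the left factor. The value `P = id` serves comodule maps,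
and `P = wordMap τ` serves the defect of the bimodule equation, which has odd degree. -/
theorem eq_map_projW_comp {X : BiTensor R V W →ₗ[R] BiTensor R V Z}
    {P : TensorAlgebra R V →ₗ[R] TensorAlgebra R V}
    (hL : coactL R V Z ∘ₗ X = TensorProduct.map P X ∘ₗ coactL R V W)
    (hR : coactR R V Z ∘ₗ X = X.rTensor (TensorAlgebra R V) ∘ₗ coactR R V W) :
    X = TensorProduct.map P ((projW R V Z ∘ₗ X).rTensor (TensorAlgebra R V)) ∘ₗ
      (coactR R V W).lTensor (TensorAlgebra R V) ∘ₗ coactL R V W := by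
  have h : X = coextend LinearMap.id (projW R V Z) ∘ₗ X := by
    rw [coextend_id_projW, LinearMap.id_comp]
  -- Writing the identity as the coextension of `projW` lets the coactions pass through `X` one
  -- after the other.
  conv_lhs => rw [h]
  simp only [coextend, LinearMap.comp_assoc, hL, wordMap_id]
  simp only [← LinearMap.comp_assoc]
  congr 1
  refine TensorProduct.ext' fun x y => ?_
  have := LinearMap.congr_fun hR y
  simp only [LinearMap.comp_apply] at this
  simp [this, LinearMap.rTensor_comp_apply]

theorem IsComoduleMap.eq_coextend {F : BiTensor R V W →ₗ[R] BiTensor R V Z}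
    (hF : IsComoduleMap F) : F = coextend LinearMap.id (projW R V Z ∘ₗ F) := by
  obtain ⟨hL, hR⟩ := isComoduleMap_iff.1 hF
  have := eq_map_projW_comp (P := LinearMap.id) (X := F) hL hR
  rw [coextend, wordMap_id]
  exact this

theorem liftOdd_eq (τ : V →ₗ[R] V) (τ' : W →ₗ[R] W)
    (ψ : TensorAlgebra R V →ₗ[R] TensorAlgebra R V) (ρ : BiTensor R V W →ₗ[R] W) :
    liftOdd τ τ' ψ ρ = ψ.rTensor (W ⊗[R] TensorAlgebra R V) + coextend τ ρ +
      TensorProduct.map (wordMap τ).toLinearMap (TensorProduct.map τ' ψ) := rfl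

variable {τ : V →ₗ[R] V} {τ' : W →ₗ[R] W} {ψ : TensorAlgebra R V →ₗ[R] TensorAlgebra R V}

theorem IsOddCoderivation.deconc_word (hψ : IsOddCoderivation τ ψ) (a : ℕ → V) (s n : ℕ) :
    deconc R V (ψ (word R a s n)) = ∑ i ∈ Finset.range (n + 1),
      (ψ (word R a s i) ⊗ₜ[R] word R a (s + i) (n - i) +
        word R (fun q => τ (a q)) s i ⊗ₜ[R] ψ (word R a (s + i) (n - i))) := by
  have := LinearMap.congr_fun hψ (word R a s n)
  simp only [LinearMap.comp_apply] at this
  rw [this]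
  simp [InfInner.deconc_word, wordMap_word, Finset.sum_add_distrib]

/-- The lift is a coderivation over `ψ`. The co-Leibniz rule splits the summand with `ψ` on the left
letters into `ψ` on the outer factor and `ψ` inside `T^W V`; the other two summands leave the outer
factor alone up to signs. -/
theorem coactL_comp_liftOdd (hψ : IsOddCoderivation τ ψ) (ρ : BiTensor R V W →ₗ[R] W) :
    coactL R V W ∘ₗ liftOdd τ τ' ψ ρ =
      (ψ.rTensor _ + TensorProduct.map (wordMap τ).toLinearMap (liftOdd τ τ' ψ ρ)) ∘ₗ
        coactL R V W := by
  simp only [liftOdd_eq, LinearMap.comp_add, TensorProduct.map_add_right, LinearMap.add_comp,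
    coactL_comp_coextend]
  rw [← add_assoc, ← add_assoc]
  congr 1
  · congr 1
    refine biWord_ext fun a k w b l => ?_
    simp [coactL, hψ.deconc_word, deconc_word, TensorProduct.sum_tmul, TensorProduct.add_tmul,
      Finset.sum_add_distrib, wordMap_word]
  · refine biWord_ext fun a k w b l => ?_
    simp [coactL_word, wordMap_word]

theorem coactR_comp_liftOdd (hψ : IsOddCoderivation τ ψ) (ρ : BiTensor R V W →ₗ[R] W) :
    coactR R V W ∘ₗ liftOdd τ τ' ψ ρ =
      ((liftOdd τ τ' ψ ρ).rTensor _ + TensorProduct.map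
        (TensorProduct.map (wordMap τ).toLinearMap
          (TensorProduct.map τ' (wordMap τ).toLinearMap)) ψ) ∘ₗ coactR R V W := by
  simp only [liftOdd_eq, LinearMap.comp_add, LinearMap.rTensor_add, LinearMap.add_comp,
    coactR_comp_coextend]
  rw [add_assoc _ _ (TensorProduct.map _ ψ ∘ₗ _)]
  congr 1
  · congr 1
    refine biWord_ext fun a k w b l => ?_
    simp [coactR_word]
  · refine biWord_ext fun a k w b l => ?_
    simp [coactR, hψ.deconc_word, deconc_word, TensorProduct.tmul_sum, TensorProduct.tmul_add,
      Finset.sum_add_distrib, wordMap_word]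

/-- A comodule map that commutes with the parity operators commutes with the lifts of `ρ` and `ρ'`
as soon as it does so after projection to the coefficients. -/
theorem IsComoduleMap.comm_of_projW {τZ : Z →ₗ[R] Z} (hψ : IsOddCoderivation τ ψ)
    {ρ : BiTensor R V W →ₗ[R] W} {ρ' : BiTensor R V Z →ₗ[R] Z}
    {F : BiTensor R V W →ₗ[R] BiTensor R V Z} (hF : IsComoduleMap F)
    (hpar : F ∘ₗ TensorProduct.map (wordMap τ).toLinearMap
          (TensorProduct.map τ' (wordMap τ).toLinearMap) =
        TensorProduct.map (wordMap τ).toLinearMap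
          (TensorProduct.map τZ (wordMap τ).toLinearMap) ∘ₗ F)
    (h : projW R V Z ∘ₗ (F ∘ₗ liftOdd τ τ' ψ ρ) = projW R V Z ∘ₗ (liftOdd τ τZ ψ ρ' ∘ₗ F)) :
    F ∘ₗ liftOdd τ τ' ψ ρ = liftOdd τ τZ ψ ρ' ∘ₗ F := by
  obtain ⟨hL, hR⟩ := isComoduleMap_iff.1 hF
  rw [← sub_eq_zero]
  -- The terms with `ψ` on the outer `TV` occur in both composites and cancel. So `X` commutes with
  -- the coactions up to `wordMap τ` on the left, and is determined by `projW ∘ X = 0`.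
  set X := F ∘ₗ liftOdd τ τ' ψ ρ - liftOdd τ τZ ψ ρ' ∘ₗ F with hX
  have hXL : coactL R V Z ∘ₗ X =
      TensorProduct.map (wordMap τ).toLinearMap X ∘ₗ coactL R V W := by
    refine LinearMap.ext fun x => ?_
    have h₁ := LinearMap.congr_fun hL (liftOdd τ τ' ψ ρ x)
    have h₂ := LinearMap.congr_fun (coactL_comp_liftOdd (τ' := τZ) hψ ρ') (F x)
    have h₃ := LinearMap.congr_fun (coactL_comp_liftOdd (τ' := τ') hψ ρ) x
    have h₄ := LinearMap.congr_fun hL x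
    simp only [LinearMap.comp_apply] at h₁ h₂ h₃ h₄
    simp only [hX, LinearMap.comp_apply, LinearMap.sub_apply, map_sub]
    rw [h₁, h₂, h₃, h₄]
    generalize coactL R V W x = y
    induction y using TensorProduct.induction_on with
    | zero => simp
    | tmul y z => simp [TensorProduct.tmul_sub]
    | add y z hy hz => simp only [map_add, ← hy, ← hz]; abel
  have hXR : coactR R V Z ∘ₗ X = X.rTensor (TensorAlgebra R V) ∘ₗ coactR R V W := by
    refine LinearMap.ext fun x => ?_
    have h₁ := LinearMap.congr_fun hR (liftOdd τ τ' ψ ρ x)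
    have h₂ := LinearMap.congr_fun (coactR_comp_liftOdd (τ' := τZ) hψ ρ') (F x)
    have h₃ := LinearMap.congr_fun (coactR_comp_liftOdd (τ' := τ') hψ ρ) x
    have h₄ := LinearMap.congr_fun hR x
    simp only [LinearMap.comp_apply] at h₁ h₂ h₃ h₄
    simp only [hX, LinearMap.comp_apply, LinearMap.sub_apply, map_sub]
    rw [h₁, h₂, h₃, h₄]
    generalize coactR R V W x = y
    induction y using TensorProduct.induction_on with
    | zero => simp
    | tmul y z =>
      -- Here `ψ` acts to the right of all of `y`, so the two Koszul signs, taken before and after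
      -- `F`, have to be compared.
      have := LinearMap.congr_fun hpar y
      simp only [LinearMap.comp_apply] at this
      simp only [LinearMap.rTensor_tmul, LinearMap.add_apply, LinearMap.sub_apply,
        LinearMap.comp_apply, map_add, TensorProduct.map_tmul, TensorProduct.sub_tmul, this]
      abel
    | add y z hy hz => simp only [map_add, ← hy, ← hz]; abel
  rw [eq_map_projW_comp hXL hXR, hX, LinearMap.comp_sub, h, sub_self]
  simp

/-- Let `ε` be the counit. Applying `ε ⊗ ε` to the co-Leibniz rule gives `ε ψ = ε ψ + ε ψ`. -/
theorem IsOddCoderivation.algebraMapInv_apply (hψ : IsOddCoderivation τ ψ)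
    (x : TensorAlgebra R V) : TensorAlgebra.algebraMapInv (ψ x) = (0 : R) := by
  have key : ∀ z : TensorAlgebra R V, (TensorProduct.lid R R).toLinearMap
      (TensorProduct.map TensorAlgebra.algebraMapInv.toLinearMap
        TensorAlgebra.algebraMapInv.toLinearMap (deconc R V z)) =
      TensorAlgebra.algebraMapInv z := by
    refine fun z => LinearMap.congr_fun (f := (TensorProduct.lid R R).toLinearMap ∘ₗ
      TensorProduct.map TensorAlgebra.algebraMapInv.toLinearMap
        TensorAlgebra.algebraMapInv.toLinearMap ∘ₗ deconc R V)
      (g := TensorAlgebra.algebraMapInv.toLinearMap) (word_ext fun a n => ?_) z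
    simp only [LinearMap.comp_apply, InfInner.deconc_word, map_sum, TensorProduct.map_tmul,
      AlgHom.toLinearMap_apply, algebraMapInv_word, LinearEquiv.coe_coe, TensorProduct.lid_tmul]
    rw [Finset.sum_eq_single 0] <;> simp +contextual
  refine LinearMap.congr_fun (f := TensorAlgebra.algebraMapInv.toLinearMap ∘ₗ ψ) (g := 0)
    (word_ext fun a n => ?_) x
  have h := key (ψ (word R a 0 n))
  simp only [hψ.deconc_word, map_sum, map_add, TensorProduct.map_tmul, Finset.sum_add_distrib,
    AlgHom.toLinearMap_apply, algebraMapInv_word, LinearEquiv.coe_coe,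
    TensorProduct.lid_tmul] at h
  rw [Finset.sum_eq_single n, Finset.sum_eq_single 0] at h
  · simpa using h
  · intro i _ hi; simp [hi]
  · simp
  · intro i hi hin
    have : n - i ≠ 0 := by simp at hi; omega
    simp [this]
  · simp

/-- The two outer summands leave a value of `ψ` in a tensor factor to which `projW` applies the
counit, and the counit kills it. -/
theorem projW_comp_liftOdd (hψ : IsOddCoderivation τ ψ) (ρ : BiTensor R V W →ₗ[R] W) :
    projW R V W ∘ₗ liftOdd τ τ' ψ ρ = ρ := by
  rw [liftOdd_eq, LinearMap.comp_add, LinearMap.comp_add, projW_comp_coextend]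
  have h₁ : projW R V W ∘ₗ ψ.rTensor (W ⊗[R] TensorAlgebra R V) = 0 :=
    TensorProduct.ext' fun x y => by simp [projW, hψ.algebraMapInv_apply]
  have h₂ : projW R V W ∘ₗ TensorProduct.map (wordMap τ).toLinearMap (TensorProduct.map τ' ψ) = 0 :=
    TensorProduct.ext_threefold' fun x w y => by simp [projW, hψ.algebraMapInv_apply]
  rw [h₁, h₂, zero_add, add_zero]

end Coextension

/-! ### Coderivations in terms of their components -/

section Coderivation

variable {R : Type*} [CommRing R] {V : Type*} [AddCommGroup V] [Module R V]
  {τ : V →ₗ[R] V} {ψ : TensorAlgebra R V →ₗ[R] TensorAlgebra R V}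

/-- Splits off the first letter: a word of positive length is its first letter times the rest. -/
theorem eq_counit_add_mul_deconc (z : TensorAlgebra R V) :
    z = algebraMap R _ (TensorAlgebra.algebraMapInv z) +
      LinearMap.mul' R _ (TensorProduct.map (TensorAlgebra.ι R ∘ₗ TensorAlgebra.ιInv)
        LinearMap.id (deconc R V z)) := by
  refine LinearMap.congr_fun (f := LinearMap.id)
    (g := Algebra.linearMap R _ ∘ₗ TensorAlgebra.algebraMapInv.toLinearMap +
      LinearMap.mul' R _ ∘ₗ TensorProduct.map (TensorAlgebra.ι R ∘ₗ TensorAlgebra.ιInv)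
        LinearMap.id ∘ₗ deconc R V) (word_ext fun a n => ?_) z
  simp only [LinearMap.id_apply, LinearMap.add_apply, LinearMap.comp_apply, deconc_word, map_sum,
    TensorProduct.map_tmul, LinearMap.mul'_apply, ιInv_word, AlgHom.toLinearMap_apply,
    algebraMapInv_word, Algebra.linearMap_apply]
  cases n with
  | zero => simp
  | succ n =>
    rw [Finset.sum_eq_single 1]
    · simp [word_succ]
    · intro i _ hi; simp [hi]
    · simp

/-- A recursion on length: the first letter of the result either comes out of a component applied to
an initial block, or is the untouched first letter, past which `ψ` moves at the cost of `τ`. -/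
theorem IsOddCoderivation.word_eq (hψ : IsOddCoderivation τ ψ) (a : ℕ → V) (s n : ℕ) :
    ψ (word R a s n) =
      ∑ m ∈ Finset.range (n + 1),
        TensorAlgebra.ι R (TensorAlgebra.ιInv (ψ (word R a s m))) * word R a (s + m) (n - m) +
      if n = 0 then 0 else TensorAlgebra.ι R (τ (a s)) * ψ (word R a (s + 1) (n - 1)) := by
  conv_lhs => rw [eq_counit_add_mul_deconc (ψ (word R a s n)), hψ.algebraMapInv_apply]
  simp only [hψ.deconc_word, map_zero, zero_add, map_sum, map_add, TensorProduct.map_tmul,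
    LinearMap.mul'_apply, LinearMap.comp_apply, LinearMap.id_apply, ιInv_word,
    Finset.sum_add_distrib]
  congr 1
  split_ifs with hn
  · subst hn; simp
  · rw [Finset.sum_eq_single 1]
    · simp
    · intro i _ hi; simp [hi]
    · simp; omega

/-- The expansion of a coderivation in terms of its components. -/
theorem IsOddCoderivation.word_eq_sum (hψ : IsOddCoderivation τ ψ)
    (h₀ : TensorAlgebra.ιInv (ψ 1) = 0) (a : ℕ → V) (s n : ℕ) :
    ψ (word R a s n) = ∑ p ∈ Finset.range n, ∑ j ∈ Finset.range (n - p),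
      word R (fun q => τ (a q)) s p *
        (TensorAlgebra.ι R (TensorAlgebra.ιInv (ψ (word R a (s + p) (j + 1)))) *
          word R a (s + p + (j + 1)) (n - p - (j + 1))) := by
  induction n generalizing s with
  | zero => rw [hψ.word_eq]; simp [h₀]
  | succ n ih =>
    conv_rhs => rw [Finset.sum_range_succ']
    rw [hψ.word_eq, Finset.sum_range_succ', if_neg (Nat.succ_ne_zero n), Nat.add_sub_cancel, ih,
      add_comm]
    congr 1
    · rw [Finset.mul_sum]
      refine Finset.sum_congr rfl fun p _ => ?_
      rw [Finset.mul_sum, show n + 1 - (p + 1) = n - p by omega]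
      refine Finset.sum_congr rfl fun j _ => ?_
      rw [word_succ _ s p, mul_assoc, show s + 1 + p = s + (p + 1) by omega]
    · simp [h₀]

end Coderivation

/-! ### Degrees in `TV` and `T^W V` -/

section Degrees

variable {R : Type*} [CommRing R] {V : Type*} [AddCommGroup V] [Module R V]
  {W : Type*} [AddCommGroup W] [Module R W] {Z : Type*} [AddCommGroup Z] [Module R Z]
  {𝒱 : ℤ → Submodule R V} {𝒲 : ℤ → Submodule R W} {𝒵 : ℤ → Submodule R Z}

theorem sgn_sum {ι : Type*} (s : Finset ι) (f : ι → ℤ) :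
    sgn R (∑ i ∈ s, f i) = ∏ i ∈ s, sgn R (f i) := by
  classical
  induction s using Finset.induction_on with
  | empty => simp
  | insert a s ha ih => rw [Finset.sum_insert ha, Finset.prod_insert ha, sgn_add, ih]

theorem word_smul (c : ℕ → R) (a : ℕ → V) (s n : ℕ) :
    word R (fun q => c q • a q) s n = (∏ i ∈ Finset.range n, c (s + i)) • word R a s n := by
  rw [word, MultilinearMap.map_smul_univ (TensorAlgebra.tprod R V n) (fun i : Fin n => c (s + i)),
    Finset.prod_range, word]

theorem word_mem_tensorDeg {a : ℕ → V} {e : ℕ → ℤ} (s n : ℕ)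
    (ha : ∀ i < n, a (s + i) ∈ 𝒱 (e (s + i))) :
    word R a s n ∈ tensorDeg 𝒱 (∑ i ∈ Finset.range n, e (s + i)) :=
  Submodule.subset_span ⟨n, _, fun i => e (s + i), fun i => ha i i.2,
    (Finset.sum_range fun i => e (s + i)).symm, rfl⟩

theorem tensorDeg_le {d : ℤ} {P : Submodule R (TensorAlgebra R V)}
    (h : ∀ (a : ℕ → V) (e : ℕ → ℤ) (n : ℕ), (∀ q, a q ∈ 𝒱 (e q)) →
      ∑ i ∈ Finset.range n, e i = d → word R a 0 n ∈ P) : tensorDeg 𝒱 d ≤ P := by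
  refine Submodule.span_le.2 ?_
  rintro _ ⟨n, v, e, hv, he, rfl⟩
  have := h (fun q => if hq : q < n then v ⟨q, hq⟩ else 0)
    (fun q => if hq : q < n then e ⟨q, hq⟩ else 0) n ?_ ?_
  · simpa [word] using this
  · intro q
    split_ifs
    · exact hv _
    · exact Submodule.zero_mem _
  · rw [← he, Finset.sum_range]
    simp

theorem biTensorDeg_le {d : ℤ} {P : Submodule R (BiTensor R V W)}
    (h : ∀ (a : ℕ → V) (e : ℕ → ℤ) (k : ℕ) (w : W) (q : ℤ) (b : ℕ → V) (f : ℕ → ℤ) (l : ℕ),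
      (∀ i, a i ∈ 𝒱 (e i)) → w ∈ 𝒲 q → (∀ i, b i ∈ 𝒱 (f i)) →
      ∑ i ∈ Finset.range k, e i + q + ∑ i ∈ Finset.range l, f i = d →
        word R a 0 k ⊗ₜ (w ⊗ₜ word R b 0 l) ∈ P) : biTensorDeg 𝒱 𝒲 d ≤ P := by
  refine Submodule.span_le.2 ?_
  rintro _ ⟨p, q, r, y, w, z, hy, hw, hz, hd, rfl⟩
  have h₁ : ∀ (a : ℕ → V) (e : ℕ → ℤ) (n : ℕ), (∀ q, a q ∈ 𝒱 (e q)) →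
      ∑ i ∈ Finset.range n, e i = p →
        tensorDeg 𝒱 r ≤ P.comap (TensorProduct.mk R _ _ (word R a 0 n) ∘ₗ TensorProduct.mk R _ _ w) :=
    fun a e n ha he => tensorDeg_le fun b f l hb hf => h a e n w q b f l ha hw hb (by omega)
  have h₂ : tensorDeg 𝒱 p ≤ P.comap ((TensorProduct.mk R _ _).flip (w ⊗ₜ z)) :=
    tensorDeg_le fun a e n ha he => h₁ a e n ha he hz
  exact h₂ hy

theorem ιInv_mem {d : ℤ} {x : TensorAlgebra R V} (hx : x ∈ tensorDeg 𝒱 d) :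
    TensorAlgebra.ιInv x ∈ 𝒱 d := by
  have : tensorDeg 𝒱 d ≤ (𝒱 d).comap TensorAlgebra.ιInv := by
    refine tensorDeg_le fun a e n ha he => ?_
    rw [Submodule.mem_comap, ιInv_word]
    split_ifs with hn
    · subst hn; simp at he; rw [← he]; exact ha 0
    · exact Submodule.zero_mem _
  exact this hx

theorem projW_mem {d : ℤ} {x : BiTensor R V W} (hx : x ∈ biTensorDeg 𝒱 𝒲 d) :
    projW R V W x ∈ 𝒲 d := by
  have : biTensorDeg 𝒱 𝒲 d ≤ (𝒲 d).comap (projW R V W) := by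
    refine biTensorDeg_le fun a e k w q b f l ha hw hb hd => ?_
    rw [Submodule.mem_comap, projW_word]
    split_ifs with h
    · obtain ⟨rfl, rfl⟩ := h; simp at hd; rwa [← hd]
    · exact Submodule.zero_mem _
  exact this hx

theorem wordMap_of_mem {τ : V →ₗ[R] V} (hτ : ∀ d, ∀ v ∈ 𝒱 d, τ v = sgn R d • v) {d : ℤ}
    {x : TensorAlgebra R V} (hx : x ∈ tensorDeg 𝒱 d) : wordMap τ x = sgn R d • x := by
  have : tensorDeg 𝒱 d ≤ LinearMap.eqLocus (wordMap τ).toLinearMap (sgn R d • LinearMap.id) := by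
    refine tensorDeg_le fun a e n ha he => ?_
    rw [LinearMap.mem_eqLocus]
    simp only [AlgHom.toLinearMap_apply, wordMap_word, hτ _ _ (ha _), LinearMap.smul_apply,
      LinearMap.id_apply]
    rw [word_smul, ← he, sgn_sum]
    simp
  exact this hx

/-- The parity operator is scalar on each degree, so maps of degree `0` commute with it. This
supplies the hypothesis `hpar` of `IsComoduleMap.comm_of_projW`. -/
theorem map_parity_of_mem {τ : V →ₗ[R] V} (hτ : ∀ d, ∀ v ∈ 𝒱 d, τ v = sgn R d • v)
    {τ' : W →ₗ[R] W} (hτ' : ∀ d, ∀ v ∈ 𝒲 d, τ' v = sgn R d • v) {d : ℤ}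
    {x : BiTensor R V W} (hx : x ∈ biTensorDeg 𝒱 𝒲 d) :
    TensorProduct.map (wordMap τ).toLinearMap (TensorProduct.map τ' (wordMap τ).toLinearMap) x =
      sgn R d • x := by
  have : biTensorDeg 𝒱 𝒲 d ≤ LinearMap.eqLocus
      (TensorProduct.map (wordMap τ).toLinearMap (TensorProduct.map τ' (wordMap τ).toLinearMap))
      (sgn R d • LinearMap.id) := by
    refine Submodule.span_le.2 ?_
    rintro _ ⟨p, q, r, y, w, z, hy, hw, hz, hd, rfl⟩
    simp only [SetLike.mem_coe, LinearMap.mem_eqLocus, TensorProduct.map_tmul,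
      AlgHom.toLinearMap_apply, wordMap_of_mem hτ hy, wordMap_of_mem hτ hz, hτ' _ _ hw,
      ← TensorProduct.smul_tmul', TensorProduct.tmul_smul, smul_smul, LinearMap.smul_apply,
      LinearMap.id_apply, ← hd, sgn_add]
    ring_nf
  exact this hx

theorem word_mem_biTensorDeg {a : ℕ → V} {e : ℕ → ℤ} {s k : ℕ} {w : W} {q : ℤ} {b : ℕ → V}
    {f : ℕ → ℤ} {s' l : ℕ} (ha : ∀ i < k, a (s + i) ∈ 𝒱 (e (s + i))) (hw : w ∈ 𝒲 q)
    (hb : ∀ i < l, b (s' + i) ∈ 𝒱 (f (s' + i))) :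
    word R a s k ⊗ₜ (w ⊗ₜ word R b s' l) ∈ biTensorDeg 𝒱 𝒲
      (∑ i ∈ Finset.range k, e (s + i) + q + ∑ i ∈ Finset.range l, f (s' + i)) :=
  Submodule.subset_span ⟨_, q, _, _, w, _, word_mem_tensorDeg s k ha, hw,
    word_mem_tensorDeg s' l hb, rfl, rfl⟩

theorem coextend_mem {ρ : BiTensor R V W →ₗ[R] Z}
    (hρ : ∀ d, ∀ x ∈ biTensorDeg 𝒱 𝒲 d, ρ x ∈ 𝒵 d) {d : ℤ} {x : BiTensor R V W}
    (hx : x ∈ biTensorDeg 𝒱 𝒲 d) : coextend LinearMap.id ρ x ∈ biTensorDeg 𝒱 𝒵 d := by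
  have : biTensorDeg 𝒱 𝒲 d ≤ (biTensorDeg 𝒱 𝒵 d).comap (coextend LinearMap.id ρ) := by
    refine biTensorDeg_le fun a e k w q b f l ha hw hb hd => ?_
    rw [Submodule.mem_comap, coextend_word]
    refine Submodule.sum_mem _ fun i hi => Submodule.sum_mem _ fun m hm => ?_
    refine Submodule.subset_span ⟨_, _, _, _, _, _,
      word_mem_tensorDeg 0 i fun i _ => ha _,
      hρ _ _ (word_mem_biTensorDeg (fun i _ => ha _) hw (fun i _ => hb _)),
      word_mem_tensorDeg (0 + m) (l - m) fun i _ => hb _, ?_, rfl⟩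
    have h₁ := Finset.sum_range_add e i (k - i)
    have h₂ := Finset.sum_range_add f m (l - m)
    rw [show i + (k - i) = k by simp at hi; omega] at h₁
    rw [show m + (l - m) = l by simp at hm; omega] at h₂
    simp only [zero_add]
    linarith
  exact this hx

end Degrees

/-- The sequence `a_t, a_{t+1}, …` with the `j` letters from position `p` on replaced by `c`. -/
def replaceBlock {α : Type*} (a : ℕ → α) (t p j : ℕ) (c : α) (q : ℕ) : α :=
  if q < p then a (t + q) else if q = p then c else a (t + (q + (j - 1)))

theorem replaceBlock_of_lt {α : Type*} (a : ℕ → α) (t : ℕ) {p : ℕ} (j : ℕ) (c : α) {q : ℕ} (h : q < p) :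
    replaceBlock a t p j c q = a (t + q) := if_pos h

@[simp] theorem replaceBlock_self {α : Type*} (a : ℕ → α) (t p j : ℕ) (c : α) :
    replaceBlock a t p j c p = c := by simp [replaceBlock]

theorem replaceBlock_of_gt {α : Type*} (a : ℕ → α) (t : ℕ) {p : ℕ} (j : ℕ) (c : α) {q : ℕ} (h : p < q) :
    replaceBlock a t p j c q = a (t + (q + (j - 1))) := by
  simp [replaceBlock, h.not_gt, h.ne']

/-! ### Both sides of the bimodule equation as sums over blocks -/

section Expansion

variable {R : Type*} [CommRing R] {A : Type*} [AddCommGroup A] [Module R A]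

/-- The component `D_n(a_s, …, a_{s+n-1})` of `D`. -/
noncomputable def comp (D : TensorAlgebra R A →ₗ[R] TensorAlgebra R A) (a : ℕ → A) (s n : ℕ) : A :=
  TensorAlgebra.ιInv (D (word R a s n))

/-- The value of the component `ρ_{k,l}` of `ρ` on a sequence, as a form in `k + l + 2` letters. -/
noncomputable def formEval (ρ : BiTensor R A A →ₗ[R] Module.Dual R A) (k l : ℕ) (b : ℕ → A) : R :=
  ρ (word R b 0 k ⊗ₜ (b k ⊗ₜ word R b (k + 1) l)) (b (k + l + 1))

theorem formEval_congr (ρ : BiTensor R A A →ₗ[R] Module.Dual R A) {k l : ℕ} {b b' : ℕ → A}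
    (h : ∀ q < k + l + 2, b q = b' q) : formEval ρ k l b = formEval ρ k l b' := by
  unfold formEval
  rw [word_congr (b := b') (s' := 0) (n := k) (fun i hi => h _ (by omega)), h k (by omega),
    word_congr (b := b') (s' := k + 1) (n := l) (fun i hi => h _ (by omega)),
    h (k + l + 1) (by omega)]

theorem formEval_smul (ρ : BiTensor R A A →ₗ[R] Module.Dual R A) (k l : ℕ) (c : ℕ → R)
    (b : ℕ → A) :
    formEval ρ k l (fun q => c q • b q) =
      (∏ q ∈ Finset.range (k + l + 2), c q) * formEval ρ k l b := by
  simp only [formEval, word_smul, ← TensorProduct.smul_tmul', TensorProduct.tmul_smul, map_smul,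
    LinearMap.smul_apply, smul_eq_mul]
  rw [Finset.prod_range_succ, show k + l + 1 = k + 1 + l by ring, Finset.prod_range_add,
    Finset.prod_range_succ]
  simp only [zero_add]
  ring

/-- Sorts the blocks of length `j + 1` starting at `p` into those left of position `k`, those
containing it (with `m` further letters behind it), and those to its right. -/
theorem sum_block_split {M : Type*} [AddCommMonoid M] (f : ℕ → ℕ → M) (k l : ℕ) :
    ∑ p ∈ Finset.range (k + l + 1), ∑ j ∈ Finset.range (k + l + 1 - p), f p j =
      ∑ p ∈ Finset.range k, ∑ j ∈ Finset.range (k - p), f p j +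
      ∑ p ∈ Finset.range (k + 1), ∑ m ∈ Finset.range (l + 1), f p (k - p + m) +
      ∑ p ∈ Finset.range l, ∑ j ∈ Finset.range (l - p), f (k + 1 + p) j := by
  have h : ∑ p ∈ Finset.range k, ∑ j ∈ Finset.range (k - p), f p j =
      ∑ p ∈ Finset.range (k + 1), ∑ j ∈ Finset.range (k - p), f p j := by
    simp [Finset.sum_range_succ]
  rw [show k + l + 1 = k + 1 + l by ring, Finset.sum_range_add, h, ← Finset.sum_add_distrib]
  congr 1
  · refine Finset.sum_congr rfl fun p hp => ?_
    rw [show k + 1 + l - p = (k - p) + (l + 1) by simp at hp; omega, Finset.sum_range_add]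
  · refine Finset.sum_congr rfl fun p hp => ?_
    rw [show k + 1 + l - (k + 1 + p) = l - p by omega]

variable (𝒜 : ℤ → Submodule R A) [DirectSum.Decomposition 𝒜]
  {D : TensorAlgebra R A →ₗ[R] TensorAlgebra R A}

theorem word_suspParity {a : ℕ → A} {d : ℕ → ℤ} (s n : ℕ)
    (ha : ∀ i < n, a (s + i) ∈ 𝒜 (d (s + i))) :
    word R (fun q => suspParity 𝒜 (a q)) s n =
      sgn R (∑ i ∈ Finset.range n, (d (s + i) + 1)) • word R a s n := by
  rw [sgn_sum, ← word_smul (fun q => sgn R (d q + 1))]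
  exact word_congr fun i hi => suspParity_of_mem 𝒜 (ha i hi)

theorem selfComponent_word (a : ℕ → A) (s k l : ℕ) :
    selfComponent D (word R a s k ⊗ₜ (a (s + k) ⊗ₜ word R a (s + k + 1) l)) =
      comp D a s (k + (1 + l)) := by
  simp [selfComponent, comp, word_add, add_assoc]

theorem dualComponent_apply (x y : TensorAlgebra R A) (φ : Module.Dual R A) (c : A) :
    dualComponent 𝒜 D (x ⊗ₜ (φ ⊗ₜ y)) c =
      φ (TensorAlgebra.ιInv (D (y * TensorAlgebra.ι R (parity 𝒜 c) * x))) := rfl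

/-- The three summands of `liftOdd` are the three kinds of block in `sum_block_split`. In each case
the sign is that of moving `D` past the `p` suspended letters before the block. -/
theorem apply_selfD_word (hD : IsOddCoderivation (suspParity 𝒜) D)
    (h₀ : TensorAlgebra.ιInv (D 1) = 0) (ρ : BiTensor R A A →ₗ[R] Module.Dual R A) (k l : ℕ)
    {a : ℕ → A} {d : ℕ → ℤ} (ha : ∀ i, a i ∈ 𝒜 (d i)) :
    ρ (selfD 𝒜 D (word R a 0 k ⊗ₜ (a k ⊗ₜ word R a (k + 1) l))) (a (k + l + 1)) =
      ∑ p ∈ Finset.range (k + l + 1), ∑ j ∈ Finset.range (k + l + 1 - p),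
        sgn R (∑ i ∈ Finset.range p, (d i + 1)) *
          formEval ρ (slot p (j + 1) k) (k + l - j - slot p (j + 1) k)
            (replaceBlock a 0 p (j + 1) (comp D a p (j + 1))) := by
  have hτ : ∀ s n, word R (fun q => suspParity 𝒜 (a q)) s n =
      sgn R (∑ i ∈ Finset.range n, (d (s + i) + 1)) • word R a s n :=
    fun s n => word_suspParity 𝒜 s n fun i _ => ha _
  rw [sum_block_split, selfD, liftOdd_eq]
  simp only [LinearMap.add_apply, map_add]
  congr 1
  · congr 1
    · rw [LinearMap.rTensor_tmul, hD.word_eq_sum h₀]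
      simp only [TensorProduct.sum_tmul, map_sum, LinearMap.sum_apply]
      refine Finset.sum_congr rfl fun p hp => Finset.sum_congr rfl fun j hj => ?_
      simp only [Finset.mem_range] at hp hj
      have hs : slot p (j + 1) k = p + (1 + (k - p - (j + 1))) := by
        unfold slot; split_ifs <;> omega
      rw [hτ, hs, ← comp]
      simp only [formEval, word_add, word_one, zero_add, replaceBlock_self]
      simp only [smul_mul_assoc, ← TensorProduct.smul_tmul', map_smul, LinearMap.smul_apply,
        smul_eq_mul]
      congr 1
      rw [word_congr (a := replaceBlock a 0 p (j + 1) (comp D a p (j + 1))) (b := a) (s := 0)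
          (s' := 0) (n := p) (fun i hi => by rw [replaceBlock_of_lt _ _ _ _ (by omega)]; simp),
        word_congr (a := replaceBlock a 0 p (j + 1) (comp D a p (j + 1))) (b := a) (s := p + 1)
          (s' := p + (j + 1)) (fun i hi => by
            rw [replaceBlock_of_gt _ _ _ _ (by omega)]; congr 1; omega),
        word_congr (a := replaceBlock a 0 p (j + 1) (comp D a p (j + 1))) (b := a)
          (s := p + (1 + (k - p - (j + 1))) + 1) (s' := k + 1)
          (fun i hi => by rw [replaceBlock_of_gt _ _ _ _ (by omega)]; congr 1; omega),
        replaceBlock_of_gt _ _ _ _ (by omega), replaceBlock_of_gt _ _ _ _ (by omega)]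
      rw [show k + l - j - (p + (1 + (k - p - (j + 1)))) = l by omega,
        show 0 + (p + (1 + (k - p - (j + 1))) + (j + 1 - 1)) = k by omega,
        show 0 + (p + (1 + (k - p - (j + 1))) + l + 1 + (j + 1 - 1)) = k + l + 1 by omega]
    · rw [coextend_word]
      simp only [map_sum, LinearMap.sum_apply]
      refine Finset.sum_congr rfl fun p hp => Finset.sum_congr rfl fun m hm => ?_
      simp only [Finset.mem_range] at hp hm
      have hs : slot p (k - p + m + 1) k = p := by
        unfold slot; split_ifs <;> omega
      have hsc := selfComponent_word (D := D) a p (k - p) m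
      rw [show p + (k - p) = k by omega, show k - p + (1 + m) = k - p + m + 1 by omega] at hsc
      rw [hτ, hs, zero_add p, hsc, show k + l - (k - p + m) - p = l - m by omega]
      simp only [formEval, zero_add, replaceBlock_self]
      simp only [← TensorProduct.smul_tmul', map_smul, LinearMap.smul_apply, smul_eq_mul]
      congr 1
      rw [word_congr (a := replaceBlock a 0 p _ _) (b := a) (s := 0)
          (s' := 0) (n := p) (fun i hi => by rw [replaceBlock_of_lt _ _ _ _ (by omega)]; simp),
        word_congr (a := replaceBlock a 0 p _ _) (b := a) (s := p + 1)
          (s' := k + 1 + m) (fun i hi => by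
            rw [replaceBlock_of_gt _ _ _ _ (by omega)]; congr 1; omega),
        replaceBlock_of_gt _ _ _ _ (by omega)]
      congr 2
      omega
  · rw [TensorProduct.map_tmul, TensorProduct.map_tmul, hD.word_eq_sum h₀]
    simp only [AlgHom.toLinearMap_apply, wordMap_word, TensorProduct.tmul_sum, map_sum,
      LinearMap.sum_apply]
    refine Finset.sum_congr rfl fun p hp => Finset.sum_congr rfl fun j hj => ?_
    simp only [Finset.mem_range] at hp hj
    have hs : slot (k + 1 + p) (j + 1) k = k := by
      unfold slot; split_ifs <;> omega
    rw [hτ, hτ, hs, ← comp, suspParity_of_mem 𝒜 (ha k),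
      show k + l - j - k = p + (1 + (l - p - (j + 1))) by omega]
    simp only [formEval, word_add, word_one, zero_add, replaceBlock_self]
    simp only [smul_mul_assoc, ← TensorProduct.smul_tmul', TensorProduct.tmul_smul, map_smul,
      LinearMap.smul_apply, smul_eq_mul]
    rw [Finset.sum_range_add, Finset.sum_range_succ]
    simp only [sgn_add]
    rw [word_congr (a := replaceBlock a 0 _ _ _) (b := a) (s := 0)
        (s' := 0) (n := k) (fun i hi => by rw [replaceBlock_of_lt _ _ _ _ (by omega)]; simp),
      word_congr (a := replaceBlock a 0 _ _ _) (b := a) (s := k + 1)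
        (s' := k + 1) (n := p)
        (fun i hi => by rw [replaceBlock_of_lt _ _ _ _ (by omega)]; simp),
      word_congr (a := replaceBlock a 0 _ _ _) (b := a) (s := k + 1 + p + 1)
        (s' := k + 1 + p + (j + 1)) (fun i hi => by
          rw [replaceBlock_of_gt _ _ _ _ (by omega)]; congr 1; omega),
      replaceBlock_of_lt _ _ _ _ (by omega), replaceBlock_of_gt _ _ _ _ (by omega)]
    rw [show 0 + (k + (p + (1 + (l - p - (j + 1)))) + 1 + (j + 1 - 1)) = k + l + 1 by omega,
      zero_add]
    ring

/-- The dual component closes the word into a circle: `D` is applied to the last `l - m` letters of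
the word, then `a_N`, then the first `t` letters. For an `N`-periodic sequence this is again a block
of consecutive letters, starting at `k + 1 + m`. -/
theorem apply_dualComponent_coextend_word (ρ : BiTensor R A A →ₗ[R] Module.Dual R A) (k l : ℕ)
    {a : ℕ → A} (hper : ∀ q, a (k + l + 2 + q) = a q) {e : ℤ} (ha : a (k + l + 1) ∈ 𝒜 e) :
    dualComponent 𝒜 D (coextend LinearMap.id ρ (word R a 0 k ⊗ₜ (a k ⊗ₜ word R a (k + 1) l)))
        (a (k + l + 1)) =
      ∑ t ∈ Finset.range (k + 1), ∑ m ∈ Finset.range (l + 1),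
        sgn R e * formEval ρ (k - t) m (replaceBlock a t (k - t + 1 + m) (l - m + 1 + t)
          (comp D a (k + 1 + m) (l - m + 1 + t))) := by
  rw [coextend_word]
  simp only [map_sum, LinearMap.sum_apply]
  refine Finset.sum_congr rfl fun t ht => Finset.sum_congr rfl fun m hm => ?_
  simp only [Finset.mem_range] at ht hm
  rw [dualComponent_apply, parity_of_mem 𝒜 ha]
  simp only [map_smul, mul_smul_comm, smul_mul_assoc, smul_eq_mul]
  congr 1
  unfold formEval
  rw [word_congr (a := replaceBlock a t _ _ _) (b := a) (s := 0) (s' := 0 + t)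
      (n := k - t) (fun i hi => by rw [replaceBlock_of_lt _ _ _ _ (by omega)]; simp),
    word_congr (a := replaceBlock a t _ _ _) (b := a) (s := k - t + 1) (s' := k + 1)
      (n := m) (fun i hi => by rw [replaceBlock_of_lt _ _ _ _ (by omega)]; congr 1; omega),
    replaceBlock_of_lt _ _ _ _ (by omega), show k - t + m + 1 = k - t + 1 + m by omega,
    replaceBlock_self, show t + (k - t) = k by omega, comp, word_add, word_add, word_one,
    show k + 1 + m + (l - m) = k + l + 1 by omega,
    word_congr (a := a) (b := a) (s := k + 1 + m + (l - m + 1)) (s' := 0) (n := t) fun i _ => by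
      rw [show k + 1 + m + (l - m + 1) + i = k + l + 2 + i by omega, hper, zero_add]]
  simp

end Expansion

/-! ### Desuspension exponents -/

section Weights

/-- The exponent `∑ᵢ (n - 1 - i) e_{s+i}` of the Koszul sign of `(s⁻¹)^{⊗ n}`. -/
def weight (e : ℕ → ℤ) (s n : ℕ) : ℤ :=
  ∑ i ∈ Finset.range n, ((n : ℤ) - 1 - i) * e (s + i)

/-- Each of the first `m` letters is also passed by the `n` desuspensions belonging to the later
letters. -/
theorem weight_add (e : ℕ → ℤ) (s m n : ℕ) :
    weight e s (m + n) =
      weight e s m + n * ∑ i ∈ Finset.range m, e (s + i) + weight e (s + m) n := by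
  simp only [weight]
  rw [Finset.sum_range_add, Finset.mul_sum, ← Finset.sum_add_distrib]
  congr 1
  · exact Finset.sum_congr rfl fun i _ => by push_cast; ring
  · exact Finset.sum_congr rfl fun i _ => by push_cast; rw [add_assoc]; ring

@[simp] theorem weight_one (e : ℕ → ℤ) (s : ℕ) : weight e s 1 = 0 := by simp [weight]

theorem weight_congr {e f : ℕ → ℤ} {s s' n : ℕ} (h : ∀ i < n, e (s + i) = f (s' + i)) :
    weight e s n = weight f s' n :=
  Finset.sum_congr rfl fun i hi => by rw [h i (Finset.mem_range.1 hi)]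

theorem weight_eq (e : ℕ → ℤ) (s n : ℕ) :
    weight e s n = ∑ i ∈ Finset.range n, ((n - 1 - i : ℕ) : ℤ) * e (s + i) :=
  Finset.sum_congr rfl fun i hi => by
    rw [Finset.mem_range] at hi
    rw [Nat.cast_sub (by omega), Nat.cast_sub (by omega)]
    simp

end Weights

/-! ### Cyclic sequences as periodic sequences -/

section Rotations

variable {α : Type*} {n : ℕ}

theorem rot_eq (a : Fin (n + 2) → α) (t q : ℕ) : rot a t q = rot a 0 (t + q) := by
  simp [rot]

theorem rot_zero_val (a : Fin (n + 2) → α) (i : Fin (n + 2)) : rot a 0 i = a i := by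
  simp [rot, Nat.mod_eq_of_lt i.2]

theorem rot_zero_add (a : Fin (n + 2) → α) (q : ℕ) : rot a 0 (n + 2 + q) = rot a 0 q := by
  simp [rot]

theorem sum_ite_lt (d : Fin (n + 2) → ℤ) {t : ℕ} (ht : t ≤ n + 2) :
    (∑ i : Fin (n + 2), if (i : ℕ) < t then d i else 0) = ∑ i ∈ Finset.range t, rot d 0 i := by
  have h := Fin.sum_univ_eq_sum_range (fun i => if i < t then rot d 0 i else 0) (n + 2)
  simp only [rot_zero_val] at h
  rw [h, ← Finset.sum_filter]
  refine Finset.sum_congr ?_ fun _ _ => rfl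
  ext i; simp; omega

theorem sum_add_sum_ite_ge (d : Fin (n + 2) → ℤ) {t : ℕ} (ht : t ≤ n + 2) :
    ∑ i ∈ Finset.range t, rot d 0 i + (∑ i : Fin (n + 2), if (i : ℕ) < t then 0 else d i) =
      ∑ i ∈ Finset.range (n + 2), rot d 0 i := by
  rw [← sum_ite_lt d ht, ← Finset.sum_add_distrib, ← Fin.sum_univ_eq_sum_range]
  refine Finset.sum_congr rfl fun i _ => ?_
  rw [rot_zero_val]
  split_ifs <;> simp

end Rotations

/-! ### Enumeration of the admissible terms -/

section Reindexing

/-- Either nothing is rotated and `a_N` stays alone in the last slot, or the block ends the rotated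
sequence. Then `t < j` says that it contains `a_N`, and `j ≤ l + 1 + t` that it starts after
`a_{k+1}`. For `t > k` a final block reaching back to `a_N` would contain `a_{k+1}`. -/
theorem admissible_iff {k l t p j : ℕ} (ht : t < k + l + 2) :
    Admissible k l t p j ↔ 2 ≤ j ∧ (t = 0 ∧ p + j ≤ k + l + 1 ∨
      t ≤ k ∧ p + j = k + l + 2 ∧ t < j ∧ j ≤ l + 1 + t) := by
  have hmod : (k + (k + l + 2 - t)) % (k + l + 2) = if t ≤ k then k - t else k + (k + l + 2 - t) := by
    split_ifs with h
    · rw [show k + (k + l + 2 - t) = k - t + (k + l + 2) by omega, Nat.add_mod_right,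
        Nat.mod_eq_of_lt (by omega)]
    · exact Nat.mod_eq_of_lt (by omega)
  unfold Admissible lastSlot specialSlot slot
  rw [hmod]
  split_ifs <;> omega

theorem specialSlot_of_le {k l t : ℕ} (p j : ℕ) (ht : t ≤ k) :
    specialSlot k l t p j = slot p j (k - t) := by
  unfold specialSlot
  rw [show k + (k + l + 2 - t) = k - t + (k + l + 2) by omega, Nat.add_mod_right,
    Nat.mod_eq_of_lt (by omega)]

/-- Adding the unrotated blocks of length one removes the restriction `j ≥ 2`. Those before `a_N`
join the first sum on the right; the block consisting of `a_N` alone is the term `t = 0`, `m = l` of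
the second. -/
theorem sum_admissible {M : Type*} [AddCommMonoid M] (k l : ℕ) (G : ℕ → ℕ → ℕ → M) :
    (∑ t ∈ Finset.range (k + l + 2), ∑ p ∈ Finset.range (k + l + 2),
      ∑ j ∈ Finset.Icc 2 (k + l + 2), if Admissible k l t p j then G t p j else 0) +
      ∑ p ∈ Finset.range (k + l + 2), G 0 p 1 =
    (∑ p ∈ Finset.range (k + l + 1), ∑ j ∈ Finset.range (k + l + 1 - p), G 0 p (j + 1)) +
      ∑ t ∈ Finset.range (k + 1), ∑ m ∈ Finset.range (l + 1),
        G t (k - t + 1 + m) (l - m + 1 + t) := by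
  classical
  set B : Finset (ℕ × ℕ × ℕ) := Finset.range (k + l + 2) ×ˢ Finset.range (k + l + 2) ×ˢ
    Finset.Icc 1 (k + l + 2) with hB
  have e₁ : (∑ t ∈ Finset.range (k + l + 2), ∑ p ∈ Finset.range (k + l + 2),
      ∑ j ∈ Finset.Icc 2 (k + l + 2), if Admissible k l t p j then G t p j else 0) =
      ∑ x ∈ B.filter (fun x => Admissible k l x.1 x.2.1 x.2.2), G x.1 x.2.1 x.2.2 := by
    rw [Finset.sum_filter, hB, Finset.sum_product]
    refine Finset.sum_congr rfl fun t _ => ?_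
    rw [Finset.sum_product]
    refine Finset.sum_congr rfl fun p _ => ?_
    refine Finset.sum_subset (Finset.Icc_subset_Icc_left (by omega)) fun j _ hj' => if_neg ?_
    intro h
    have := h.1
    have := h.2.1
    simp only [Finset.mem_Icc, not_and] at hj'
    omega
  have e₂ : ∑ p ∈ Finset.range (k + l + 2), G 0 p 1 =
      ∑ x ∈ B.filter (fun x => x.1 = 0 ∧ x.2.2 = 1), G x.1 x.2.1 x.2.2 := by
    refine Finset.sum_nbij' (fun p => (0, p, 1)) (fun x => x.2.1) ?_ ?_ ?_ ?_ ?_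
    · intro p hp; simp [hB] at hp ⊢; omega
    · rintro ⟨t, p, j⟩ hx; simp [hB] at hx ⊢; omega
    · intro p _; rfl
    · rintro ⟨t, p, j⟩ hx; simp [hB] at hx ⊢; omega
    · intro p _; rfl
  have e₃ : (∑ p ∈ Finset.range (k + l + 1), ∑ j ∈ Finset.range (k + l + 1 - p), G 0 p (j + 1)) =
      ∑ x ∈ B.filter (fun x => x.1 = 0 ∧ x.2.1 + x.2.2 ≤ k + l + 1), G x.1 x.2.1 x.2.2 := by
    rw [Finset.sum_sigma']
    refine Finset.sum_nbij' (fun x => (0, x.1, x.2 + 1)) (fun x => ⟨x.2.1, x.2.2 - 1⟩) ?_ ?_ ?_ ?_ ?_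
    · rintro ⟨p, j⟩ hx; simp [hB] at hx ⊢; omega
    · rintro ⟨t, p, j⟩ hx; simp [hB] at hx ⊢; omega
    · rintro ⟨p, j⟩ hx; simp
    · rintro ⟨t, p, j⟩ hx; simp [hB] at hx ⊢; omega
    · intro x _; rfl
  have e₄ : (∑ t ∈ Finset.range (k + 1), ∑ m ∈ Finset.range (l + 1),
        G t (k - t + 1 + m) (l - m + 1 + t)) =
      ∑ x ∈ B.filter (fun x => x.1 ≤ k ∧ x.2.1 + x.2.2 = k + l + 2 ∧ x.1 < x.2.2 ∧
        x.2.2 ≤ l + 1 + x.1), G x.1 x.2.1 x.2.2 := by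
    rw [Finset.sum_sigma']
    refine Finset.sum_nbij' (fun x => (x.1, k - x.1 + 1 + x.2, l - x.2 + 1 + x.1))
      (fun x => ⟨x.1, l + 1 + x.1 - x.2.2⟩) ?_ ?_ ?_ ?_ ?_
    · rintro ⟨t, m⟩ hx; simp [hB] at hx ⊢; omega
    · rintro ⟨t, p, j⟩ hx; simp [hB] at hx ⊢; omega
    · rintro ⟨t, m⟩ hx; simp at hx ⊢; omega
    · rintro ⟨t, p, j⟩ hx; simp [hB] at hx ⊢; omega
    · intro x _; rfl
  rw [e₁, e₂, e₃, e₄, ← Finset.sum_union, ← Finset.sum_union]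
  · refine Finset.sum_congr ?_ fun _ _ => rfl
    ext ⟨t, p, j⟩
    simp only [hB, Finset.mem_union, Finset.mem_filter, Finset.mem_product, Finset.mem_range,
      Finset.mem_Icc]
    constructor
    · rintro (⟨h, h'⟩ | ⟨h, h'⟩)
      · rw [admissible_iff h.1] at h'
        omega
      · omega
    · intro h
      by_cases hj : t = 0 ∧ j = 1
      · right; omega
      · left
        rw [admissible_iff (by omega)]
        omega
  · rw [Finset.disjoint_filter]
    rintro ⟨t, p, j⟩ _ h₁ h₂
    simp only at h₁ h₂
    omega
  · rw [Finset.disjoint_filter]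
    rintro ⟨t, p, j⟩ _ h₁ h₂
    have := h₁.1
    simp only at h₂ this
    omega

end Reindexing

/-! ### Desuspended operations and forms -/

section Forms

variable {R : Type*} [CommRing R] {A : Type*} [AddCommGroup A] [Module R A]
  (𝒜 : ℤ → Submodule R A) {D : TensorAlgebra R A →ₗ[R] TensorAlgebra R A}

/-- One unit of the shift by `2` is the degree of `D`, the other is the desuspension of the output.
-/
theorem comp_mem (hD : ∀ d : ℤ, ∀ x ∈ tensorDeg (susp 𝒜) d, D x ∈ tensorDeg (susp 𝒜) (d - 1))
    {a : ℕ → A} {d : ℕ → ℤ} (s n : ℕ) (ha : ∀ i < n, a (s + i) ∈ 𝒜 (d (s + i))) :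
    comp D a s n ∈ 𝒜 (∑ i ∈ Finset.range n, (d (s + i) + 1) - 2) := by
  have h := ιInv_mem (hD _ _ (word_mem_tensorDeg (𝒱 := susp 𝒜) (e := fun q => d q + 1) s n
    fun i hi => by simpa [susp] using ha i hi))
  have h' : comp D a s n ∈ 𝒜 (∑ i ∈ Finset.range n, (d (s + i) + 1) - 1 - 1) := h
  rwa [sub_sub] at h'

/-- `ρ` has degree `0`. -/
def HasDegreeZero (ρ : BiTensor R A A →ₗ[R] Module.Dual R A) : Prop :=
  ∀ d, ∀ x ∈ biTensorDeg (susp 𝒜) (susp 𝒜) d, ρ x ∈ susp (dualGrading 𝒜) d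

theorem formEval_eq_zero {ρ : BiTensor R A A →ₗ[R] Module.Dual R A} (hρ : HasDegreeZero 𝒜 ρ)
    {k l : ℕ} {b : ℕ → A} {d : ℕ → ℤ} (hb : ∀ q < k + l + 2, b q ∈ 𝒜 (d q))
    (hd : ∑ q ∈ Finset.range (k + l + 2), d q + k + l ≠ 0) : formEval ρ k l b = 0 := by
  have h := hρ _ _ (word_mem_biTensorDeg (𝒱 := susp 𝒜) (𝒲 := susp 𝒜) (e := fun q => d q + 1)
    (f := fun q => d q + 1) (a := b) (b := b) (s := 0) (k := k) (w := b k) (q := d k + 1)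
    (s' := k + 1) (l := l) (fun i hi => by simpa [susp] using hb _ (by omega))
    (by simpa [susp] using hb k (by omega)) (fun i hi => by simpa [susp] using hb _ (by omega)))
  refine h (d (k + l + 1)) ?_ _ (hb _ (by omega))
  rw [Finset.sum_range_succ, show k + l + 1 = k + 1 + l by ring, Finset.sum_range_add,
    Finset.sum_range_succ] at hd
  simp only [Finset.sum_add_distrib, Finset.sum_const, Finset.card_range, zero_add]
  rw [show k + l + 1 = k + 1 + l by ring]
  intro h'
  apply hd
  simp at h'
  linarith

variable [DirectSum.Decomposition 𝒜]

theorem mulOp_eq_smul_comp {a : ℕ → A} {d : ℕ → ℤ} (s n : ℕ)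
    (ha : ∀ i < n, a (s + i) ∈ 𝒜 (d (s + i))) :
    mulOp 𝒜 D n (fun i => a (s + i)) = sgn R (weight (fun q => d q + 1) s n) • comp D a s n := by
  have h : TensorAlgebra.tprod R A n (fun i => (suspParity 𝒜 ^ (n - 1 - (i : ℕ))) (a (s + i))) =
      word R (fun q => sgn R (((n - 1 - (q - s) : ℕ) : ℤ) * (d q + 1)) • a q) s n := by
    unfold word
    congr 1
    funext i
    rw [suspParity_pow_of_mem 𝒜 (ha i i.2)]
    simp
  rw [mulOp, h, word_smul, map_smul, map_smul, comp, weight_eq, sgn_sum]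
  simp

theorem formOf_eq_formEval (F : BiTensor R A A →ₗ[R] BiTensor R A (Module.Dual R A)) (k l : ℕ)
    (b : ℕ → A) : formOf 𝒜 F k l (fun i => b i) =
      formEval (projW R A _ ∘ₗ F) k l (fun q => (suspParity 𝒜 ^ (k + l - q)) (b q)) := by
  unfold formOf formEval word
  simp only [zero_add, LinearMap.comp_apply]
  -- Truncated subtraction gives the last argument, at position `k + l + 1`, the exponent `0`: it is
  -- not desuspended.
  rw [show k + l - k = l by omega, show k + l - (k + l + 1) = 0 by omega]
  congr 7
  funext i
  rw [show k + l - (k + 1 + (i : ℕ)) = l - 1 - i by omega]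

theorem formEval_pow {ρ : BiTensor R A A →ₗ[R] Module.Dual R A} {k l : ℕ} {b : ℕ → A} {d : ℕ → ℤ}
    (hb : ∀ q < k + l + 2, b q ∈ 𝒜 (d q)) :
    formEval ρ k l (fun q => (suspParity 𝒜 ^ (k + l - q)) (b q)) =
      sgn R (weight (fun q => d q + 1) 0 (k + l + 1)) * formEval ρ k l b := by
  rw [formEval_congr (b' := fun q => sgn R (((k + l - q : ℕ) : ℤ) * (d q + 1)) • b q) ρ
    (fun q hq => suspParity_pow_of_mem 𝒜 (hb q hq) _), formEval_smul, weight_eq, sgn_sum,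
    Finset.prod_range_succ]
  simp [show k + l - (k + l + 1) = 0 by omega]

/-- Two desuspensions are undone: the one inside `m_j`, and the one of the form, where the output of
`m_j` counts with the suspended degree of its inputs lowered by one. -/
theorem insertTerm_eq (form : FormSystem R A) {ρ : BiTensor R A A →ₗ[R] Module.Dual R A}
    (hform : ∀ k l (b : ℕ → A), form k l (fun i => b i) =
      formEval ρ k l (fun q => (suspParity 𝒜 ^ (k + l - q)) (b q)))
    (hD : ∀ d : ℤ, ∀ x ∈ tensorDeg (susp 𝒜) d, D x ∈ tensorDeg (susp 𝒜) (d - 1))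
    {k l : ℕ} {a : Fin (k + l + 2) → A} {d : Fin (k + l + 2) → ℤ} (ha : ∀ i, a i ∈ 𝒜 (d i))
    {t p j r s : ℕ} (hr : specialSlot k l t p j = r) (hs : k + l + 1 - j - r = s)
    (hp : p < r + s + 2) :
    insertTerm 𝒜 D form k l a t p j =
      sgn R (weight (fun q => rot d 0 q + 1) (t + p) j) *
        (sgn R (weight (replaceBlock (fun q => rot d 0 q + 1) t p j
          (∑ i ∈ Finset.range j, (rot d 0 (t + p + i) + 1) - 1)) 0 (r + s + 1)) *
        formEval ρ r s (replaceBlock (rot a 0) t p j (comp D (rot a 0) (t + p) j))) := by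
  subst hr hs
  set r := specialSlot k l t p j
  set s := k + l + 1 - j - r
  have ha' : ∀ q, rot a 0 q ∈ 𝒜 (rot d 0 q) := fun q => ha _
  have h₁ : insertTerm 𝒜 D form k l a t p j = form r s (fun q => replaceBlock (rot a 0) t p j
      (sgn R (weight (fun q => rot d 0 q + 1) (t + p) j) • comp D (rot a 0) (t + p) j) q) := by
    unfold insertTerm
    congr 1
    funext q
    rw [← mulOp_eq_smul_comp 𝒜 (t + p) j fun i _ => ha' _]
    unfold insertArgs replaceBlock
    simp only [rot_eq a t, add_assoc]
  have h₂ : ∀ c, (fun q : Fin (r + s + 2) => replaceBlock (rot a 0) t p j c q) =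
      Function.update (fun q : Fin (r + s + 2) => replaceBlock (rot a 0) t p j 0 q) ⟨p, hp⟩ c := by
    intro c
    funext q
    rcases eq_or_ne q ⟨p, hp⟩ with rfl | hq
    · simp
    · have : (q : ℕ) ≠ p := fun h => hq (Fin.ext h)
      simp [hq, replaceBlock, this]
  rw [h₁, h₂, MultilinearMap.map_update_smul, ← h₂, hform, smul_eq_mul,
    formEval_pow 𝒜 (d := replaceBlock (rot d 0) t p j
      (∑ i ∈ Finset.range j, (rot d 0 (t + p + i) + 1) - 2))]
  · congr 3
    refine weight_congr fun q _ => ?_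
    unfold replaceBlock
    split_ifs <;> ring
  · intro q _
    unfold replaceBlock
    split_ifs
    · exact ha' _
    · exact comp_mem 𝒜 hD _ _ fun i _ => ha' _
    · exact ha' _

end Forms

/-! ### Comparison of signs -/

section SignComparison

/-- Here `j` is the block length, `p` the number of letters before the block, and `q` the number
after it, not counting `a_N`. The `S` are sums of suspended degrees and the `w` are weights. -/
theorem parity_insert_inside : ∀ wj wp wq Sp Sj p j q : ZMod 2,
    j * (Sp - p) + p * (j + 1) + j + wj + (wp + (1 + q) * Sp + (q * (Sj - 1) + wq)) =
      wp + (j + q) * Sp + (wj + q * Sj + wq) + (p + j + q) - 1 + 1 + Sp := by decide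

/-- Here `t` letters are wrapped to the end, `p` letters precede the block, `u` letters of the block
precede `a_N`, and `dn` is the degree of `a_N`. The hypothesis is the parity of the degree condition
on the form. -/
theorem parity_insert_around : ∀ wt wp wu St Sp Su dn t p u : ZMod 2,
    St + Sp + Su + dn = 0 →
    (St - t) * (Sp - p + (Su - u) + dn) + t * (p + u + 1) + (u + 1 + t) * (Sp - p) +
        p * (u + 1 + t + 1) + (u + 1 + t) + (wu + (1 + t) * Su + (t * (dn + 1) + wt)) + wp =
      wt + (p + u) * St + (wp + u * Sp + wu) + (t + p + u) - 1 + dn := by decide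

variable {R : Type*} [CommRing R] {A : Type*} [AddCommGroup A] [Module R A]
  (𝒜 : ℤ → Submodule R A) [DirectSum.Decomposition 𝒜]
  {D : TensorAlgebra R A →ₗ[R] TensorAlgebra R A} (form : FormSystem R A)
  {ρ : BiTensor R A A →ₗ[R] Module.Dual R A}

theorem insertTerm_inside
    (hform : ∀ k l (b : ℕ → A), form k l (fun i => b i) =
      formEval ρ k l (fun q => (suspParity 𝒜 ^ (k + l - q)) (b q)))
    (hD : ∀ d : ℤ, ∀ x ∈ tensorDeg (susp 𝒜) d, D x ∈ tensorDeg (susp 𝒜) (d - 1))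
    {k l : ℕ} {a : Fin (k + l + 2) → A} {d : Fin (k + l + 2) → ℤ} (ha : ∀ i, a i ∈ 𝒜 (d i))
    {p j : ℕ} (hpj : p + j < k + l + 1) :
    sgn R (signExp k l 0 p (j + 1) d) * insertTerm 𝒜 D form k l a 0 p (j + 1) =
      -(sgn R (weight (fun q => rot d 0 q + 1) 0 (k + l + 1) + (k + l)) *
        (sgn R (∑ i ∈ Finset.range p, (rot d 0 i + 1)) *
          formEval ρ (slot p (j + 1) k) (k + l - j - slot p (j + 1) k)
            (replaceBlock (rot a 0) 0 p (j + 1) (comp D (rot a 0) p (j + 1))))) := by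
  obtain ⟨q, hq⟩ : ∃ q, k + l + 1 = p + ((j + 1) + q) := ⟨k + l - p - j, by omega⟩
  have hsl : slot p (j + 1) k + (k + l - j - slot p (j + 1) k) + 1 = p + (1 + q) := by
    unfold slot; split_ifs <;> omega
  rw [insertTerm_eq 𝒜 form hform hD ha (r := slot p (j + 1) k)
    (s := k + l - j - slot p (j + 1) k) (specialSlot_of_le _ _ (Nat.zero_le k)) (by omega)
    (by omega), zero_add p, ← mul_assoc, ← mul_assoc, ← mul_assoc, ← neg_mul, hsl]
  congr 1
  rw [← sgn_add, ← sgn_add, ← sgn_add, ← neg_one_mul, ← sgn_one, ← sgn_add]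
  refine sgn_congr ?_
  rw [weight_add _ _ p, weight_add _ _ 1, hq, weight_add _ 0 p, weight_add _ _ (j + 1) q]
  rw [weight_congr (e := replaceBlock _ _ _ _ _) (f := fun q => rot d 0 q + 1) (s' := 0) (n := p)
      (fun i hi => by rw [replaceBlock_of_lt _ _ _ _ (by omega)]; simp),
    weight_congr (e := replaceBlock _ _ _ _ _) (f := fun q => rot d 0 q + 1) (s' := p + (j + 1))
      (n := q) (fun i hi => by
        rw [replaceBlock_of_gt _ _ _ _ (by omega)]
        rw [show 0 + (0 + p + 1 + i + (j + 1 - 1)) = p + (j + 1) + i by omega]),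
    Finset.sum_congr rfl (g := fun i => rot d 0 (0 + i) + 1) fun i hi => by
      rw [replaceBlock_of_lt _ _ _ _ (by simpa using hi)]; simp]
  have h := parity_insert_inside (weight (fun q => rot d 0 q + 1) p (j + 1) : ℤ)
    (weight (fun q => rot d 0 q + 1) 0 p : ℤ) (weight (fun q => rot d 0 q + 1) (p + (j + 1)) q : ℤ)
    (∑ i ∈ Finset.range p, (rot d 0 i + 1) : ℤ)
    (∑ i ∈ Finset.range (j + 1), (rot d 0 (p + i) + 1) : ℤ) p (j + 1 : ℕ) q
  have hkl : (k : ZMod 2) + l + 1 = p + ((j + 1 : ℕ) + q) := by exact_mod_cast congrArg _ hq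
  have hs : ∑ i ∈ Finset.range p, rot d 0 i = ∑ i ∈ Finset.range p, (rot d 0 i + 1) - p := by
    simp [Finset.sum_add_distrib]
  simp only [signExp, zero_add, weight_one, replaceBlock_self, Finset.sum_range_one, add_zero,
    Nat.not_lt_zero, if_false, Finset.sum_const_zero, zero_mul, Nat.cast_zero, hs]
  generalize ∑ i ∈ Finset.range p, (rot d 0 i + 1) = Sp at *
  generalize ∑ i ∈ Finset.range (j + 1), (rot d 0 (p + i) + 1) = Sj at *
  push_cast at h hkl ⊢
  linear_combination h - hkl

theorem insertTerm_around (hρ : HasDegreeZero 𝒜 ρ)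
    (hform : ∀ k l (b : ℕ → A), form k l (fun i => b i) =
      formEval ρ k l (fun q => (suspParity 𝒜 ^ (k + l - q)) (b q)))
    (hD : ∀ d : ℤ, ∀ x ∈ tensorDeg (susp 𝒜) d, D x ∈ tensorDeg (susp 𝒜) (d - 1))
    {k l : ℕ} {a : Fin (k + l + 2) → A} {d : Fin (k + l + 2) → ℤ} (ha : ∀ i, a i ∈ 𝒜 (d i))
    {t m : ℕ} (ht : t ≤ k) (hm : m ≤ l) :
    sgn R (signExp k l t (k - t + 1 + m) (l - m + 1 + t) d) *
        insertTerm 𝒜 D form k l a t (k - t + 1 + m) (l - m + 1 + t) =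
      sgn R (weight (fun q => rot d 0 q + 1) 0 (k + l + 1) + (k + l)) *
        (sgn R (rot d 0 (k + l + 1)) * formEval ρ (k - t) m
          (replaceBlock (rot a 0) t (k - t + 1 + m) (l - m + 1 + t)
            (comp D (rot a 0) (k + 1 + m) (l - m + 1 + t)))) := by
  obtain ⟨p, hp⟩ : ∃ p, p = k - t + 1 + m := ⟨_, rfl⟩
  obtain ⟨u, hu⟩ : ∃ u, u = l - m := ⟨_, rfl⟩
  have hsl : slot p (u + 1 + t) (k - t) = k - t := by unfold slot; split_ifs <;> omega
  have ha' : ∀ q, rot a 0 q ∈ 𝒜 (rot d 0 q) := fun q => ha _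
  rw [← hp, ← hu, insertTerm_eq 𝒜 form hform hD ha (r := k - t)
    (s := m) ((specialSlot_of_le _ _ ht).trans hsl) (by omega) (by omega),
    show k - t + m + 1 = p by omega, show k + 1 + m = t + p by omega]
  set e : ℕ → ℤ := rot d 0 with he
  have hper : ∀ i, e (k + l + 2 + i) = e i := rot_zero_add d
  have hsum : ∑ i ∈ Finset.range (k + l + 2), e i = ∑ i ∈ Finset.range t, (e i + 1) +
      ∑ i ∈ Finset.range p, (e (t + i) + 1) + ∑ i ∈ Finset.range u, (e (t + p + i) + 1) +
      e (k + l + 1) - (k + l + 1) := by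
    rw [Finset.sum_range_succ, show k + l + 1 = t + p + u by omega, Finset.sum_range_add,
      Finset.sum_range_add]
    simp only [Finset.sum_add_distrib, Finset.sum_const, Finset.card_range]
    have : (k : ℤ) + l + 1 = t + p + u := by omega
    rw [this]
    simp
    ring
  have hblock : ∑ i ∈ Finset.range (u + 1 + t), (e (t + p + i) + 1) =
      ∑ i ∈ Finset.range u, (e (t + p + i) + 1) + (e (k + l + 1) + 1) +
        ∑ i ∈ Finset.range t, (e i + 1) := by
    rw [Finset.sum_range_add, Finset.sum_range_succ, show t + p + u = k + l + 1 by omega]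
    congr 1
    refine Finset.sum_congr rfl fun i _ => ?_
    rw [show t + p + (u + 1 + i) = k + l + 2 + i by omega, hper]
  -- Inserting `m_j` into a form of degree `r + s` can give a nonzero value only in this total
  -- degree; otherwise `formEval` vanishes on both sides.
  by_cases hdeg : ∑ i ∈ Finset.range (k + l + 2), e i + k + l = 1
  · rw [← mul_assoc, ← mul_assoc, ← mul_assoc]
    congr 1
    rw [← sgn_add, ← sgn_add, ← sgn_add]
    refine sgn_congr ?_
    have hodd : (∑ i : Fin (k + l + 2), if (i : ℕ) < t then 0 else d i) =
        ∑ i ∈ Finset.range p, (e (t + i) + 1) - p + (∑ i ∈ Finset.range u, (e (t + p + i) + 1) - u)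
          + e (k + l + 1) := by
      have h₁ := sum_add_sum_ite_ge d (t := t) (by omega)
      rw [← he, hsum] at h₁
      have h₂ : ∑ i ∈ Finset.range t, (e i + 1) = ∑ i ∈ Finset.range t, e i + t := by
        simp [Finset.sum_add_distrib]
      have : (k : ℤ) + l + 1 = t + p + u := by omega
      linarith
    have hw₁ : weight (fun q => e q + 1) (t + p) (u + 1 + t) =
        weight (fun q => e q + 1) (t + p) u +
          (1 + t) * ∑ i ∈ Finset.range u, (e (t + p + i) + 1) +
          (t * (e (k + l + 1) + 1) + weight (fun q => e q + 1) 0 t) := by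
      rw [add_assoc u, weight_add, weight_add]
      rw [weight_congr (s := t + p + u + 1) (s' := 0) (f := fun q => e q + 1) fun i _ => by
        rw [show t + p + u + 1 + i = k + l + 2 + (0 + i) by omega, hper]]
      simp [show t + p + u = k + l + 1 by omega]
    have hw₂ : weight (fun q => e q + 1) 0 (k + l + 1) =
        weight (fun q => e q + 1) 0 t + (p + u) * ∑ i ∈ Finset.range t, (e i + 1) +
          (weight (fun q => e q + 1) t p + u * ∑ i ∈ Finset.range p, (e (t + i) + 1) +
            weight (fun q => e q + 1) (t + p) u) := by
      rw [show k + l + 1 = t + (p + u) by omega, weight_add, weight_add]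
      simp
    have hw₃ : ∀ c, weight (replaceBlock (fun q => e q + 1) t p (u + 1 + t) c) 0 p =
        weight (fun q => e q + 1) t p := fun c =>
      weight_congr fun i hi => by rw [replaceBlock_of_lt _ _ _ _ (by omega)]; simp
    have h₁ : ∑ i ∈ Finset.range t, e i = ∑ i ∈ Finset.range t, (e i + 1) - t := by
      simp [Finset.sum_add_distrib]
    have h₂ : ∑ i ∈ Finset.range p, e (t + i) = ∑ i ∈ Finset.range p, (e (t + i) + 1) - p := by
      simp [Finset.sum_add_distrib]
    rw [hw₁, hw₂, hw₃]
    unfold signExp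
    simp only [rot_eq d t, ← he]
    rw [hodd, sum_ite_lt d (by omega), ← he, h₁, h₂]
    rw [hsum] at hdeg
    have hkl : (k : ZMod 2) + l + 1 = t + p + u := by
      exact_mod_cast congrArg (Nat.cast (R := ZMod 2)) (show k + l + 1 = t + p + u by omega)
    have hdeg' := congrArg (Int.cast (R := ZMod 2)) hdeg
    generalize ∑ i ∈ Finset.range t, (e i + 1) = St at *
    generalize ∑ i ∈ Finset.range p, (e (t + i) + 1) = Sp at *
    generalize ∑ i ∈ Finset.range u, (e (t + p + i) + 1) = Su at *
    have two : (2 : ZMod 2) = 0 := rfl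
    have h := parity_insert_around (weight (fun q => e q + 1) 0 t : ℤ)
      (weight (fun q => e q + 1) t p : ℤ) (weight (fun q => e q + 1) (t + p) u : ℤ)
      St Sp Su (e (k + l + 1)) t p u (by push_cast at hdeg' ⊢; linear_combination hdeg' + two)
    push_cast at h ⊢
    linear_combination h + (t - 1) * hkl
  · rw [formEval_eq_zero 𝒜 hρ (d := replaceBlock e t p (u + 1 + t)
      (∑ i ∈ Finset.range (u + 1 + t), (e (t + p + i) + 1) - 2))]
    · simp
    · intro q _
      unfold replaceBlock
      split_ifs
      · exact ha' _
      · exact comp_mem 𝒜 hD _ _ fun i _ => ha' _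
      · exact ha' _
    · rw [show k - t + m + 2 = p + 1 by omega, Finset.sum_range_succ, replaceBlock_self,
        Finset.sum_congr rfl (g := fun i => e (t + i)) fun i hi =>
          replaceBlock_of_lt _ t (u + 1 + t) _ (by simpa using hi), hblock]
      rw [hsum] at hdeg
      have h₂ : ∑ i ∈ Finset.range p, (e (t + i) + 1) = ∑ i ∈ Finset.range p, e (t + i) + p := by
        simp [Finset.sum_add_distrib]
      intro h
      apply hdeg
      have : ((k - t : ℕ) : ℤ) + m + 1 = p := by omega
      linarith

end SignComparison

/-! ### The relation as the evaluated bimodule equation -/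

section Relation

variable {R : Type*} [CommRing R] {A : Type*} [AddCommGroup A] [Module R A]
  (𝒜 : ℤ → Submodule R A) [DirectSum.Decomposition 𝒜]
  {D : TensorAlgebra R A →ₗ[R] TensorAlgebra R A} (form : FormSystem R A)
  {ρ : BiTensor R A A →ₗ[R] Module.Dual R A}

/-- For `t = 0` and `j = 1` the exponent `signExp` is, modulo 2, one more than the sum of the
preceding degrees. So the `∂`-terms become missing terms of the right hand side. -/
theorem sgn_mul_form_update {k l : ℕ} (a : Fin (k + l + 2) → A) (d : Fin (k + l + 2) → ℤ)
    (i : Fin (k + l + 2)) :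
    sgn R (∑ j ∈ Finset.univ.filter (· < i), d j) *
        form k l (Function.update a i (mulOp 𝒜 D 1 (fun _ => a i))) =
      -(sgn R (signExp k l 0 i 1 d) * insertTerm 𝒜 D form k l a 0 i 1) := by
  have hs : specialSlot k l 0 i 1 = k := by
    rw [specialSlot_of_le _ _ (Nat.zero_le k)]
    unfold slot
    split_ifs <;> omega
  -- The number of arguments depends on `r` and `s`, so the equalities of indices are substituted
  -- for variables rather than rewritten.
  have hf : ∀ r s (b : ℕ → A), r = k → s = l →
      form r s (fun q => b q) = form k l (fun q => b q) := by rintro _ _ b rfl rfl; rfl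
  have hterm : insertTerm 𝒜 D form k l a 0 i 1 =
      form k l (fun q => insertArgs 𝒜 D a 0 i 1 q) :=
    hf _ _ (insertArgs 𝒜 D a 0 i 1) hs (by omega)
  have hargs : (fun q : Fin (k + l + 2) => insertArgs 𝒜 D a 0 i 1 q) =
      Function.update a i (mulOp 𝒜 D 1 (fun _ => a i)) := by
    funext q
    rcases eq_or_ne q i with rfl | hq
    · simp [insertArgs, rot_zero_val]
    · have : (q : ℕ) ≠ i := fun h => hq (Fin.ext h)
      simp [insertArgs, this, hq, rot_zero_val]
  rw [hterm, hargs, ← neg_mul]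
  congr 1
  rw [← neg_one_mul, ← sgn_one, ← sgn_add]
  refine sgn_congr ?_
  have h : ∑ j ∈ Finset.univ.filter (· < i), d j = ∑ q ∈ Finset.range i, rot d 0 q := by
    rw [← sum_ite_lt d i.2.le, Finset.sum_filter]
    rfl
  have two : (2 : ZMod 2) = 0 := rfl
  rw [h]
  simp only [signExp, Nat.not_lt_zero, if_false, Finset.sum_const_zero]
  push_cast
  linear_combination (-(i : ZMod 2) - 1) * two

/-- The two sides of the relation for inner products differ, up to sign, by the values of the two
sides of the bimodule equation. -/
theorem relation_sub (hA : IsAInfinityAlgebra 𝒜 D) (hρ : HasDegreeZero 𝒜 ρ)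
    (hform : ∀ k l (b : ℕ → A), form k l (fun i => b i) =
      formEval ρ k l (fun q => (suspParity 𝒜 ^ (k + l - q)) (b q)))
    {k l : ℕ} {a : Fin (k + l + 2) → A} {d : Fin (k + l + 2) → ℤ} (ha : ∀ i, a i ∈ 𝒜 (d i)) :
    (∑ t ∈ Finset.range (k + l + 2), ∑ p ∈ Finset.range (k + l + 2),
      ∑ j ∈ Finset.Icc 2 (k + l + 2), if Admissible k l t p j then
          sgn R (signExp k l t p j d) * insertTerm 𝒜 D form k l a t p j else 0) -
      ∑ i : Fin (k + l + 2), sgn R (∑ j ∈ Finset.univ.filter (· < i), d j) *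
          form k l (Function.update a i (mulOp 𝒜 D 1 (fun _ => a i))) =
    sgn R (weight (fun q => rot d 0 q + 1) 0 (k + l + 1) + (k + l)) *
      (dualComponent 𝒜 D (coextend LinearMap.id ρ
          (word R (rot a 0) 0 k ⊗ₜ (rot a 0 k ⊗ₜ word R (rot a 0) (k + 1) l)))
        (rot a 0 (k + l + 1)) -
      ρ (selfD 𝒜 D (word R (rot a 0) 0 k ⊗ₜ (rot a 0 k ⊗ₜ word R (rot a 0) (k + 1) l)))
        (rot a 0 (k + l + 1))) := by
  have ha' : ∀ q, rot a 0 q ∈ 𝒜 (rot d 0 q) := fun q => ha _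
  simp only [sgn_mul_form_update, Finset.sum_neg_distrib, sub_neg_eq_add]
  rw [Fin.sum_univ_eq_sum_range (fun i => sgn R (signExp k l 0 i 1 d) *
      insertTerm 𝒜 D form k l a 0 i 1), sum_admissible k l (fun t p j =>
      sgn R (signExp k l t p j d) * insertTerm 𝒜 D form k l a t p j),
    apply_selfD_word 𝒜 hA.coderivation hA.zero_comp ρ k l ha',
    apply_dualComponent_coextend_word 𝒜 ρ k l (rot_zero_add a) (ha' _), mul_sub, sub_eq_neg_add]
  simp only [Finset.mul_sum, ← Finset.sum_neg_distrib]
  congr 1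
  · refine Finset.sum_congr rfl fun p hp => Finset.sum_congr rfl fun j hj => ?_
    simp only [Finset.mem_range] at hp hj
    exact insertTerm_inside 𝒜 form hform hA.degree ha (by omega)
  · refine Finset.sum_congr rfl fun t ht => Finset.sum_congr rfl fun m hm => ?_
    simp only [Finset.mem_range] at ht hm
    exact insertTerm_around 𝒜 form hρ hform hA.degree ha (by omega) (by omega)

end Relation

/-! ### Recovering `ρ` from its forms -/

section Reconstruction

variable {R : Type*} [CommRing R] {A : Type*} [AddCommGroup A] [Module R A]

/-- The sequence `a₀, …, a_{k-1}, w, b₀, …, b_{l-1}, c, c, …`. -/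
def glue {α : Type*} (a : ℕ → α) (k : ℕ) (w : α) (b : ℕ → α) (l : ℕ) (c : α) (q : ℕ) : α :=
  if q < k then a q else if q = k then w else if q < k + 1 + l then b (q - (k + 1)) else c

theorem formEval_glue (ρ : BiTensor R A A →ₗ[R] Module.Dual R A) (a : ℕ → A) (k : ℕ) (w : A)
    (b : ℕ → A) (l : ℕ) (c : A) :
    formEval ρ k l (glue a k w b l c) = ρ (word R a 0 k ⊗ₜ (w ⊗ₜ word R b 0 l)) c := by
  unfold formEval
  rw [word_congr (b := a) (s' := 0) (n := k) fun i hi => by simp [glue, hi],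
    word_congr (b := b) (s' := 0) (n := l) fun i hi => by
      simp [glue, hi, show ¬ k + 1 + i < k by omega, show k + 1 + i ≠ k by omega]]
  simp [glue, show ¬ k + l + 1 < k by omega, show k + l + 1 ≠ k by omega,
    show ¬ k + l + 1 < k + 1 + l by omega]

theorem glue_mem {ℳ : ℤ → Submodule R A} {a b : ℕ → A} {w c : A} {d f : ℕ → ℤ} {x y : ℤ}
    (ha : ∀ q, a q ∈ ℳ (d q)) (hw : w ∈ ℳ x) (hb : ∀ q, b q ∈ ℳ (f q)) (hc : c ∈ ℳ y)
    (k l q : ℕ) : glue a k w b l c q ∈ ℳ (glue d k x f l y q) := by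
  unfold glue
  split_ifs
  exacts [ha _, hw, hb _, hc]

theorem sum_glue (d : ℕ → ℤ) (k : ℕ) (x : ℤ) (f : ℕ → ℤ) (l : ℕ) (y : ℤ) :
    ∑ q ∈ Finset.range (k + l + 2), glue d k x f l y q =
      ∑ q ∈ Finset.range k, d q + x + ∑ q ∈ Finset.range l, f q + y := by
  rw [Finset.sum_range_succ, show k + l + 1 = k + 1 + l by ring, Finset.sum_range_add,
    Finset.sum_range_succ]
  congr 1
  · congr 1
    · congr 1
      · exact Finset.sum_congr rfl fun q hq => by simp [glue, Finset.mem_range.1 hq]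
      · simp [glue]
    · refine Finset.sum_congr rfl fun q hq => ?_
      simp [glue, Finset.mem_range.1 hq, show ¬ k + 1 + q < k by omega,
        show k + 1 + q ≠ k by omega]
  · simp [glue, show ¬ k + 1 + l < k by omega, show k + 1 + l ≠ k by omega]

theorem ext_formEval {ρ ρ' : BiTensor R A A →ₗ[R] Module.Dual R A}
    (h : ∀ k l (b : ℕ → A), formEval ρ k l b = formEval ρ' k l b) : ρ = ρ' :=
  biWord_ext fun a k w b l => LinearMap.ext fun c => by
    rw [← formEval_glue, ← formEval_glue, h]

theorem ext_formEval_homogeneous (𝒜 : ℤ → Submodule R A) [DirectSum.Decomposition 𝒜]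
    {ρ ρ' : BiTensor R A A →ₗ[R] Module.Dual R A}
    (h : ∀ k l (b : Fin (k + l + 2) → A) (d : Fin (k + l + 2) → ℤ), (∀ i, b i ∈ 𝒜 (d i)) →
      formEval ρ k l (rot b 0) = formEval ρ' k l (rot b 0)) : ρ = ρ' := by
  have hmem : ∀ a ∈ {a | ∃ d, a ∈ 𝒜 d} ∪ {0}, ∃ d, a ∈ 𝒜 d := by
    rintro a (ha | ha)
    · exact ha
    · exact ⟨0, by rw [Set.mem_singleton_iff.1 ha]; exact Submodule.zero_mem _⟩
  refine biWord_ext_of_span _ (span_homogeneous 𝒜) _ (span_homogeneous 𝒜)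
    fun a k w b l ha hw hb => LinearMap.ext_on (span_homogeneous 𝒜) ?_
  rintro c ⟨y, hc⟩
  obtain ⟨x, hw⟩ := hw
  choose d hd using fun q => hmem _ (ha q)
  choose f hf using fun q => hmem _ (hb q)
  have hrot : ∀ q < k + l + 2,
      glue a k w b l c q = rot (fun i : Fin (k + l + 2) => glue a k w b l c i) 0 q := by
    intro q hq
    simp [rot, Nat.mod_eq_of_lt hq]
  rw [← formEval_glue, ← formEval_glue, formEval_congr ρ hrot, formEval_congr ρ' hrot]
  exact h k l _ (fun i => glue d k x f l y i) fun i => glue_mem hd hw hf hc k l i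

/-- The linear map on `TV` that agrees with `f n` on words of length `n`. -/
noncomputable def ofLength {M : Type*} [AddCommMonoid M] [Module R M]
    (f : ℕ → TensorAlgebra R A →ₗ[R] M) : TensorAlgebra R A →ₗ[R] M :=
  DirectSum.toModule R ℕ M (fun n => f n ∘ₗ TensorPower.toTensorAlgebra) ∘ₗ
    (TensorAlgebra.equivDirectSum (R := R) (M := A)).toLinearMap

theorem equivDirectSum_word (a : ℕ → A) (s n : ℕ) :
    (TensorAlgebra.equivDirectSum (R := R) (M := A)) (word R a s n) =
      DirectSum.lof R ℕ (fun n => ⨂[R]^n A) n (PiTensorProduct.tprod R fun i => a (s + i)) := by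
  rw [DirectSum.lof_eq_of]
  exact TensorAlgebra.toDirectSum_tensorPower_tprod _

theorem ofLength_word {M : Type*} [AddCommMonoid M] [Module R M]
    (f : ℕ → TensorAlgebra R A →ₗ[R] M) (a : ℕ → A) (s n : ℕ) :
    ofLength f (word R a s n) = f n (word R a s n) := by
  simp only [ofLength, LinearMap.comp_apply, AlgEquiv.toLinearMap_apply, equivDirectSum_word,
    DirectSum.toModule_lof]
  rw [TensorPower.toTensorAlgebra_tprod]
  rfl

/-- The value of a multilinear form on words, extended by zero to other lengths. -/
noncomputable def wordForm {n : ℕ} (f : MultilinearMap R (fun _ : Fin n => A) R) :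
    TensorAlgebra R A →ₗ[R] R :=
  PiTensorProduct.lift f ∘ₗ DirectSum.component R ℕ (fun n => ⨂[R]^n A) n ∘ₗ
    (TensorAlgebra.equivDirectSum (R := R) (M := A)).toLinearMap

theorem wordForm_word {n : ℕ} (f : MultilinearMap R (fun _ : Fin n => A) R) (a : ℕ → A) (s : ℕ) :
    wordForm f (word R a s n) = f (fun i => a (s + i)) := by
  simp only [wordForm, LinearMap.comp_apply, AlgEquiv.toLinearMap_apply, equivDirectSum_word,
    DirectSum.component.lof_self, PiTensorProduct.lift.tprod]

/-- The map `(x, y) ↦ (w ↦ (c ↦ f(x, w, y, c)))`. -/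
noncomputable def sandwich (f : TensorAlgebra R A →ₗ[R] R) :
    TensorAlgebra R A →ₗ[R] TensorAlgebra R A →ₗ[R] A →ₗ[R] Module.Dual R A :=
  LinearMap.mk₂ R (fun x y => LinearMap.mk₂ R
      (fun w c => f (x * TensorAlgebra.ι R w * (y * TensorAlgebra.ι R c)))
      (by intros; simp [mul_add, add_mul]) (by intros; simp)
      (by intros; simp [mul_add]) (by intros; simp))
    (by intros; ext; simp [add_mul]) (by intros; ext; simp)
    (by intros; ext; simp [mul_add, add_mul]) (by intros; ext; simp)

/-- `TV` is the direct sum of its tensor powers, so the components for different `(k, l)` may be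
prescribed independently, once for the left and once for the right word. -/
theorem exists_formEval_eq (form : FormSystem R A) :
    ∃ ρ : BiTensor R A A →ₗ[R] Module.Dual R A,
      ∀ k l (b : ℕ → A), formEval ρ k l b = form k l (fun i => b i) := by
  let C : TensorAlgebra R A →ₗ[R] TensorAlgebra R A →ₗ[R] A →ₗ[R] Module.Dual R A :=
    ofLength fun k => (ofLength fun l => (sandwich (wordForm (form k l))).flip).flip
  refine ⟨TensorProduct.lift
    { toFun := fun x => TensorProduct.lift (C x).flip
      map_add' := by intros; ext; simp
      map_smul' := by intros; ext; simp }, fun k l b => ?_⟩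
  have h : word R b 0 k * TensorAlgebra.ι R (b k) *
      (word R b (k + 1) l * TensorAlgebra.ι R (b (k + l + 1))) = word R b 0 (k + l + 2) := by
    rw [show k + l + 2 = (k + 1) + (l + 1) by ring, word_add, word_succ', word_succ',
      zero_add, zero_add, show k + 1 + l = k + l + 1 by ring]
  simp only [formEval, TensorProduct.lift.tmul, LinearMap.coe_mk, AddHom.coe_mk,
    LinearMap.flip_apply, C, ofLength_word, sandwich, LinearMap.mk₂_apply, h, wordForm_word]
  simp

end Reconstruction

/-! ### The bijection -/

section MainTheorem

variable {R : Type*} [CommRing R] {A : Type*} [AddCommGroup A] [Module R A]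

/-- `formEval` as a multilinear map. -/
noncomputable def formEvalMultilinear (ρ : BiTensor R A A →ₗ[R] Module.Dual R A) (k l : ℕ) :
    MultilinearMap R (fun _ : Fin (k + l + 2) => A) R :=
  MultilinearMap.uncurryRight (ρ.compMultilinearMap
    (((TensorAlgebra.tprod R A k).domCoprod
      ((MultilinearMap.ofSubsingleton R A A (0 : Fin 1) LinearMap.id).domCoprod
        (TensorAlgebra.tprod R A l))).domDomCongr
      (((Equiv.refl (Fin k)).sumCongr finSumFinEquiv).trans
        (finSumFinEquiv.trans (finCongr (by omega : k + (1 + l) = k + l + 1))))))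

theorem formEvalMultilinear_apply (ρ : BiTensor R A A →ₗ[R] Module.Dual R A) (k l : ℕ)
    (b : ℕ → A) : formEvalMultilinear ρ k l (fun i => b i) = formEval ρ k l b := by
  simp [formEvalMultilinear, formEval, word, Fin.init, add_assoc]

variable (𝒜 : ℤ → Submodule R A)

theorem suspParityDual_of_mem [DirectSum.Decomposition 𝒜] (d : ℤ) (φ : Module.Dual R A)
    (hφ : φ ∈ susp (dualGrading 𝒜) d) : suspParityDual 𝒜 φ = sgn R d • φ := by
  refine LinearMap.ext_on (span_homogeneous 𝒜) ?_
  rintro a ⟨i, ha⟩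
  simp only [suspParityDual, LinearMap.neg_apply, LinearMap.dualMap_apply, parity_of_mem 𝒜 ha,
    map_smul, LinearMap.smul_apply, smul_eq_mul]
  by_cases hi : i = -(d - 1)
  · rw [← neg_mul, ← neg_one_mul (sgn R i), ← sgn_one, ← sgn_add, hi]
    congr 1
    refine sgn_congr ?_
    have two : (2 : ZMod 2) = 0 := rfl
    push_cast
    linear_combination (1 - (d : ZMod 2)) * two
  · rw [hφ i hi a ha]; simp

variable [DirectSum.Decomposition 𝒜] {D : TensorAlgebra R A →ₗ[R] TensorAlgebra R A}

theorem isInfinityInnerProduct_coextend_iff (hD : IsOddCoderivation (suspParity 𝒜) D)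
    {ρ : BiTensor R A A →ₗ[R] Module.Dual R A} (hρ : HasDegreeZero 𝒜 ρ) :
    IsInfinityInnerProduct 𝒜 D (coextend LinearMap.id ρ) ↔
      dualComponent 𝒜 D ∘ₗ coextend LinearMap.id ρ = ρ ∘ₗ selfD 𝒜 D := by
  have h₁ : projW R A (Module.Dual R A) ∘ₗ (coextend LinearMap.id ρ ∘ₗ selfD 𝒜 D) =
      ρ ∘ₗ selfD 𝒜 D := by
    rw [← LinearMap.comp_assoc, projW_comp_coextend]
  have h₂ : projW R A (Module.Dual R A) ∘ₗ (dualD 𝒜 D ∘ₗ coextend LinearMap.id ρ) =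
      dualComponent 𝒜 D ∘ₗ coextend LinearMap.id ρ := by
    rw [← LinearMap.comp_assoc, dualD, projW_comp_liftOdd hD]
  constructor
  · intro h
    rw [← h₁, ← h₂, h.comm]
  · intro h
    refine ⟨fun d x hx => coextend_mem hρ hx, isComoduleMap_coextend ρ,
      (isComoduleMap_coextend ρ).comm_of_projW hD ?_ (h₁.trans (h.symm.trans h₂.symm))⟩
    have hτ : ∀ d, ∀ v ∈ susp 𝒜 d, suspParity 𝒜 v = sgn R d • v := by
      intro d v hv
      rw [suspParity_of_mem 𝒜 hv, sub_add_cancel]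
    have hmem : ∀ a ∈ {a | ∃ d, a ∈ 𝒜 d} ∪ {0}, ∃ d, a ∈ susp 𝒜 d := by
      rintro a (⟨d, ha⟩ | ha)
      · exact ⟨d + 1, by simpa [susp] using ha⟩
      · exact ⟨0, by rw [Set.mem_singleton_iff.1 ha]; exact Submodule.zero_mem _⟩
    refine biWord_ext_of_span _ (span_homogeneous 𝒜) _ (span_homogeneous 𝒜)
      fun a k w b l ha hw hb => ?_
    obtain ⟨x, hw⟩ := hmem w (Or.inl hw)
    choose d hd using fun q => hmem _ (ha q)
    choose f hf using fun q => hmem _ (hb q)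
    have hx := word_mem_biTensorDeg (s := 0) (k := k) (s' := 0) (l := l)
      (fun i _ => hd _) hw (fun i _ => hf _)
    rw [LinearMap.comp_apply, LinearMap.comp_apply, map_parity_of_mem hτ hτ hx,
      map_parity_of_mem hτ (suspParityDual_of_mem 𝒜) (coextend_mem hρ hx), map_smul]

theorem isInfinityInnerProduct_iff_isInnerProductSystem (hA : IsAInfinityAlgebra 𝒜 D)
    {ρ : BiTensor R A A →ₗ[R] Module.Dual R A} (hρ : HasDegreeZero 𝒜 ρ) {form : FormSystem R A}
    (hform : ∀ k l (b : ℕ → A), form k l (fun i => b i) =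
      formEval ρ k l (fun q => (suspParity 𝒜 ^ (k + l - q)) (b q))) :
    IsInfinityInnerProduct 𝒜 D (coextend LinearMap.id ρ) ↔ IsInnerProductSystem 𝒜 D form := by
  have hunit : ∀ e (x : R), sgn R e * x = 0 ↔ x = 0 := fun e x =>
    ⟨fun h => by rw [← one_mul x, ← sgn_mul_self (R := R) e, mul_assoc, h, mul_zero],
      fun h => by rw [h, mul_zero]⟩
  rw [isInfinityInnerProduct_coextend_iff 𝒜 hA.coderivation hρ]
  constructor
  · intro h
    refine ⟨fun k l a d ha hd => ?_, fun k l a d ha => ?_⟩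
    · have ha' : ∀ q, rot a 0 q ∈ 𝒜 (rot d 0 q) := fun q => ha _
      have := hform k l (rot a 0)
      simp only [rot_zero_val] at this
      rw [this, formEval_pow 𝒜 fun q _ => ha' q,
        formEval_eq_zero 𝒜 hρ (fun q _ => ha' q), mul_zero]
      rwa [← Fin.sum_univ_eq_sum_range, Finset.sum_congr rfl fun i _ => rot_zero_val d i]
    · refine (sub_eq_zero.1 ?_).symm
      rw [relation_sub 𝒜 form hA hρ hform ha, hunit, sub_eq_zero]
      exact LinearMap.congr_fun (LinearMap.congr_fun h _) _
  · intro h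
    refine ext_formEval_homogeneous 𝒜 fun k l a d ha => ?_
    have := sub_eq_zero.2 (h.relation k l a d ha).symm
    rw [relation_sub 𝒜 form hA hρ hform ha, hunit, sub_eq_zero] at this
    exact this

/-- The equivalence between equation and relation presupposes that `ρ` has degree `0`; for a given
system this has to come from the degree condition on the forms. -/
theorem hasDegreeZero_of_isInnerProductSystem
    {ρ : BiTensor R A A →ₗ[R] Module.Dual R A} {form : FormSystem R A}
    (hform : ∀ k l (b : ℕ → A), form k l (fun i => b i) =
      formEval ρ k l (fun q => (suspParity 𝒜 ^ (k + l - q)) (b q)))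
    (h : IsInnerProductSystem 𝒜 D form) : HasDegreeZero 𝒜 ρ := by
  intro e
  refine biTensorDeg_le (P := (susp (dualGrading 𝒜) e).comap ρ)
    fun a d k w x b f l ha hw hb he y hy c hc => ?_
  -- The degrees at hand are suspended ones, except for the final argument `c`; hence the shifts by
  -- one.
  have hmem := glue_mem (ℳ := 𝒜) (d := fun q => d q - 1) (f := fun q => f q - 1) ha hw hb hc k l
  have h₁ := h.degree k l (fun i => glue a k w b l c i) _ (fun i => hmem i) ?_
  · rw [hform, formEval_pow 𝒜 fun q _ => hmem q] at h₁
    rw [← formEval_glue, ← one_mul (formEval _ _ _ _), ← sgn_mul_self (R := R), mul_assoc, h₁,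
      mul_zero]
  · rw [Fin.sum_univ_eq_sum_range (glue (fun q => d q - 1) k (x - 1) (fun q => f q - 1) l y),
      sum_glue]
    intro h₀
    apply hy
    simp only [Finset.sum_sub_distrib, Finset.sum_const, Finset.card_range] at h₀
    simp at h₀
    linarith

/-- Taking components is a bijection from `∞`-inner-products onto systems of inner products. -/
theorem exists_equiv_isInnerProductSystem (hD : IsAInfinityAlgebra 𝒜 D) :
    ∃ e : {F : BiTensor R A A →ₗ[R] BiTensor R A (Module.Dual R A) //
            IsInfinityInnerProduct 𝒜 D F} ≃
          {form : FormSystem R A // IsInnerProductSystem 𝒜 D form},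
      ∀ F k l (a : Fin (k + l + 2) → A), (e F).1 k l a = formOf 𝒜 F.1 k l a := by
  let Φ : (BiTensor R A A →ₗ[R] BiTensor R A (Module.Dual R A)) → FormSystem R A := fun F k l =>
    (formEvalMultilinear (projW R A _ ∘ₗ F) k l).compLinearMap
      fun i => suspParity 𝒜 ^ (k + l - (i : ℕ))
  have hΦ : ∀ F k l (b : ℕ → A), Φ F k l (fun i => b i) =
      formEval (projW R A _ ∘ₗ F) k l (fun q => (suspParity 𝒜 ^ (k + l - q)) (b q)) :=
    fun F k l b => formEvalMultilinear_apply _ k l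
      (fun q => (suspParity 𝒜 ^ (k + l - q)) (b q))
  have hΦ' : ∀ F k l (a : Fin (k + l + 2) → A), Φ F k l a = formOf 𝒜 F k l a := by
    intro F k l a
    have ha : a = fun i : Fin (k + l + 2) => rot a 0 i := funext fun i => (rot_zero_val a i).symm
    rw [ha, hΦ, formOf_eq_formEval]
  have hsystem : ∀ F, IsInfinityInnerProduct 𝒜 D F → IsInnerProductSystem 𝒜 D (Φ F) := by
    intro F hF
    refine (isInfinityInnerProduct_iff_isInnerProductSystem 𝒜 hD
      (fun d x hx => projW_mem (hF.degree d x hx)) (hΦ F)).1 ?_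
    rwa [← hF.comodule.eq_coextend]
  refine ⟨Equiv.ofBijective (fun F => ⟨Φ F.1, hsystem F.1 F.2⟩) ⟨?_, ?_⟩,
    fun F k l a => hΦ' F.1 k l a⟩
  · rintro ⟨F, hF⟩ ⟨F', hF'⟩ h
    have h' : Φ F = Φ F' := congrArg Subtype.val h
    refine Subtype.ext ?_
    have : projW R A (Module.Dual R A) ∘ₗ F = projW R A _ ∘ₗ F' := by
      refine ext_formEval fun k l b => ?_
      -- Evaluating at arguments already carrying the desuspension signs cancels those signs.
      have hb := congrArg (fun f : FormSystem R A => f k l fun i =>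
        (suspParity 𝒜 ^ (k + l - (i : ℕ))) (b i)) h'
      simpa only [hΦ _ k l (fun q => (suspParity 𝒜 ^ (k + l - q)) (b q)),
        suspParity_pow_apply_self] using hb
    change F = F'
    rw [hF.comodule.eq_coextend, hF'.comodule.eq_coextend, this]
  · rintro ⟨form, h⟩
    -- The forms are twisted by the desuspension signs first; twisting again returns the given
    -- system.
    obtain ⟨ρ, hρ⟩ := exists_formEval_eq fun k l => (form k l).compLinearMap
      fun i => suspParity 𝒜 ^ (k + l - (i : ℕ))
    have hform : ∀ k l (b : ℕ → A), form k l (fun i => b i) =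
        formEval ρ k l (fun q => (suspParity 𝒜 ^ (k + l - q)) (b q)) := by
      intro k l b
      simp [hρ, MultilinearMap.compLinearMap_apply, suspParity_pow_apply_self]
    have hdeg := hasDegreeZero_of_isInnerProductSystem 𝒜 hform h
    refine ⟨⟨coextend LinearMap.id ρ,
      (isInfinityInnerProduct_iff_isInnerProductSystem 𝒜 hD hdeg hform).2 h⟩, Subtype.ext ?_⟩
    funext k l
    refine MultilinearMap.ext fun a => ?_
    have ha : a = fun i : Fin (k + l + 2) => rot a 0 i := funext fun i => (rot_zero_val a i).symm
    change Φ (coextend LinearMap.id ρ) k l a = form k l a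
    rw [ha, hΦ, projW_comp_coextend, hform]

end MainTheorem

end InfInner

theorem proposition5p4 {R : Type*} [CommRing R] {A : Type*} [AddCommGroup A] [Module R A]
    (𝒜 : ℤ → Submodule R A) [DirectSum.Decomposition 𝒜]
    (D : TensorAlgebra R A →ₗ[R] TensorAlgebra R A)
    (hD : InfInner.IsAInfinityAlgebra 𝒜 D) :
    ∃ e : {F : InfInner.BiTensor R A A →ₗ[R] InfInner.BiTensor R A (Module.Dual R A) //
            InfInner.IsInfinityInnerProduct 𝒜 D F} ≃
          {form : InfInner.FormSystem R A // InfInner.IsInnerProductSystem 𝒜 D form},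
      ∀ F k l (a : Fin (k + l + 2) → A), (e F).1 k l a = InfInner.formOf 𝒜 F.1 k l a :=
  InfInner.exists_equiv_isInnerProductSystem 𝒜 hD
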